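/- **Theorem.** Let $m\in\mathbb Z_{\ge 0}$ and $M\in\mathbb Z_{\ge 1}$ with $\gcd(M,4m+2)=1$, and write $q^x=e^{2\pi i\tau x}$ for $\operatorname{Im}\tau>0$. *Numerator of the supercharacter of the $\widehat{osp}_{3|2}$-module $L(m\Lambda_0)$ and its modification.* Let $\Phi^{[B;m]}(\tau,z_1,z_2,t)=\Phi_1(\tau,z_1,z_2,t)-\Phi_1(\tau,z_2,z_1,t)$, where $$\Phi_1(\tau,z_1,z_2,t)=e^{2\pi i(m+\frac12)t}\sum_{j\in\mathbb Z}(-1)^j\,\frac{e^{\pi i j(2m+1)(z_1+z_2)+\pi i z_1}\,q^{(m+\frac12)j^2+\frac j2}}{1-e^{2\pi i z_1}q^j}.$$ Let $\Theta^-_{j,d}(\tau,z)=\sum_{n\in\mathbb Z}(-1)^n e^{2\pi i d z(n+\frac{j}{2d})}q^{d(n+\frac{j}{2d})^2}$, $E(x)=2\int_0^x e^{-\pi u^2}du$, and for $j\in\mathbb Z$ $$R_{j}(\tau,v)=\sum_{\substack{n\in\frac12+\mathbb Z\\ n\equiv j+\frac12\bmod 2m+1}}(-1)^{n-(j+\frac12)}\Big\{\operatorname{sgn}(n)-E\Big(\big(n+(2m+1)\tfrac{\operatorname{Im}v}{\operatorname{Im}\tau}\big)\sqrt{\tfrac{\operatorname{Im}\tau}{m+\frac12}}\Big)\Big\}e^{-\frac{\pi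 i n^2\tau}{2m+1}-2\pi i n v}.$$ Put $\widetilde\Phi^{[B;m]}=\Phi^{[B;m]}+\Phi^{[B;m]}_{add}$, where $$\Phi^{[B;m]}_{add}(\tau,z_1,z_2,t)=\tfrac12 e^{2\pi i(m+\frac12)t}\sum_{j=0}^{2m}R_{j}\big(\tau,\tfrac{z_1-z_2}2\big)\big(\Theta^-_{j+\frac12,m+\frac12}+\Theta^-_{-(j+\frac12),m+\frac12}\big)(\tau,z_1+z_2).$$ *Modified (super)characters.* For $\epsilon,\epsilon'\in\{0,\frac12\}$ let $$\Omega^{[B;M;\epsilon]}=\{(j,k)\in(\epsilon+\mathbb Z)^2\mid -M\le j<M,\ 0\le k<M,\ j-k\in2\mathbb Z\},$$ and for $a,b\in\epsilon'+\mathbb Z$ with $a-b\in2\mathbb Z$ let $$\widetilde\Psi^{[B;M,m;\epsilon]}_{a,b;\epsilon'}(\tau,z_1,z_2,t)=q^{\frac{2m+1}{2M}ab}\,e^{\frac{2\pi i(2m+1)}{2M}(bz_1+az_2)}\,\widetilde\Phi^{[B;m]}\big(M\tau,z_1+a\tau+\epsilon,z_2+b\tau+\epsilon,\tfrac tM\big).$$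 Let $\eta$ be the Dedekind eta function, $\vartheta_{ab}(\tau,z)=\sum_{n\in\mathbb Z}e^{\pi i\tau(n+\frac a2)^2+2\pi i(n+\frac a2)(z+\frac b2)}$ for $a,b\in\{0,1\}$, and let $$\widehat R^{(\epsilon)}_{\epsilon'}(\tau,z_1,z_2,t)=e^{\frac{\pi i}2(2(\epsilon-\epsilon')-4\epsilon\epsilon'-1)}\,e^{\pi i t}\,\frac{\eta(\tau)^3\,\vartheta_{11}(\tau,z_1+z_2)\,\vartheta_{11}(\tau,\frac{z_1-z_2}2)}{\vartheta_{1-2\epsilon',1-2\epsilon}(\tau,z_1)\,\vartheta_{1-2\epsilon',1-2\epsilon}(\tau,z_2)\,\vartheta_{1-2\epsilon',1-2\epsilon}(\tau,\frac{z_1+z_2}2)}$$ be the normalized denominators ($\epsilon=\frac12$) and superdenominators ($\epsilon=0$) of $\widehat{osp}_{3|2}$, untwisted for $\epsilon'=0$ and twisted for $\epsilon'=\frac12$. The modified normalized principal admissible characters ($\epsilon=\frac12$) and supercharacters ($\epsilon=0$), untwisted ($\epsilon'=0$) and twisted ($\epsilon'=\frac12$), associated to the pair $(M,m\Lambda_0)$,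 are $$\widetilde{ch}^{[B;M,m;\epsilon]}_{j,k;\epsilon'}=(-1)^{j-\epsilon'}\,\widetilde\Psi^{[B;M,m;\epsilon]}_{j,k;\epsilon'}\big/\widehat R^{(\epsilon)}_{\epsilon'},\qquad (j,k)\in\Omega^{[B;M;\epsilon']}$$ (at the points where the quotient has a pole or is undefined, its value is taken to be $0$). Then for all $\epsilon,\epsilon'\in\{0,\frac12\}$, all $(j,k)\in\Omega^{[B;M;\epsilon']}$, and all $\tau,z_1,z_2,t\in\mathbb C$ with $\operatorname{Im}\tau>0$: 1. $$\widetilde{ch}^{[B;M,m;\epsilon]}_{j,k;\epsilon'}\Big(-\frac1\tau,\frac{z_1}\tau,\frac{z_2}\tau,t-\frac{z_1z_2}\tau\Big)=\frac{i^{4\epsilon\epsilon'+2\epsilon-2\epsilon'}}M\sum_{(a,b)\in\Omega^{[B;M;\epsilon]}}e^{-\frac{\pi i(2m+1)}M(bj+ak)}\,\widetilde{ch}^{[B;M,m;\epsilon']}_{a,b;\epsilon}(\tau,z_1,z_2,t);$$ 2. $$\widetilde{ch}^{[B;M,m;\epsilon]}_{j,k;\epsilon'}(\tau+1,z_1,z_2,t)=(-1)^{4\epsilon\epsilon'}e^{\frac{\pi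 i(2m+1)}Mjk+\pi i(j-\frac52\epsilon')}\,\widetilde{ch}^{[B;M,m;|\epsilon-\epsilon'|]}_{j,k;\epsilon'}(\tau,z_1,z_2,t).$$ Consequently, 3. the $\mathbb C$-span of all the functions $\widetilde{ch}^{[B;M,m;\epsilon]}_{j,k;\epsilon'}$ ($\epsilon,\epsilon'\in\{0,\frac12\}$, $(j,k)\in\Omega^{[B;M;\epsilon']}$) is invariant under the action of $SL_2(\mathbb Z)$, $$(F|_A)(\tau,z_1,z_2,t)=F\Big(\frac{a\tau+b}{c\tau+d},\frac{z_1}{c\tau+d},\frac{z_2}{c\tau+d},t-\frac{c\,z_1z_2}{c\tau+d}\Big),\qquad A=\begin{pmatrix}a&b\\c&d\end{pmatrix}.$$ -/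

import Mathlib

namespace OspModular

/-- `q ^ x = exp (2 π i τ x)`, where `q = exp (2 π i τ)`. -/
noncomputable def qPow (τ x : ℂ) : ℂ :=
  Complex.exp (2 * Real.pi * Complex.I * τ * x)

/-- `E(x) = 2 ∫_0^x exp (-π u²) du`. -/
noncomputable def errE (x : ℝ) : ℝ :=
  2 * ∫ u in (0 : ℝ)..x, Real.exp (-Real.pi * u ^ 2)

/-- The alternate theta function
`Θ⁻_{j,d}(τ, z) = ∑_{n ∈ ℤ} (-1)^n exp (2 π i d z (n + j/(2d))) q^{d (n + j/(2d))²}`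
of degree `d` (at `t = 0`). -/
noncomputable def thetaMinus (j d : ℝ) (τ z : ℂ) : ℂ :=
  ∑' n : ℤ, (-1 : ℂ) ^ n
    * Complex.exp (2 * Real.pi * Complex.I * d * z * (n + j / (2 * d)))
    * qPow τ (d * (n + j / (2 * d)) ^ 2)

/-- The function `Φ₁^{[B;m]}(τ, z₁, z₂, t)`. -/
noncomputable def phiOne (m : ℕ) (τ z₁ z₂ t : ℂ) : ℂ :=
  Complex.exp (2 * Real.pi * Complex.I * (m + 1 / 2) * t) *
    ∑' j : ℤ, (-1 : ℂ) ^ j *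
      (Complex.exp (Real.pi * Complex.I * j * (2 * m + 1) * (z₁ + z₂) + Real.pi * Complex.I * z₁)
        * qPow τ ((m + 1 / 2) * j ^ 2 + j / 2)
        / (1 - Complex.exp (2 * Real.pi * Complex.I * z₁) * qPow τ j))

/-- The function `Φ^{[B;m]}`: the numerator of the supercharacter of `L(mΛ₀)`. -/
noncomputable def phi (m : ℕ) (τ z₁ z₂ t : ℂ) : ℂ :=
  phiOne m τ z₁ z₂ t - phiOne m τ z₂ z₁ t

/-- The real analytic function `R^{[B]}_{j+1/2, m+1/2}(τ, v)`. The summation index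
`n ∈ 1/2 + ℤ`, `n ≡ j + 1/2 mod 2m+1`, is written as `n = j + 1/2 + (2m+1) l`, `l ∈ ℤ`. -/
noncomputable def zwegersR (m : ℕ) (j : ℤ) (τ v : ℂ) : ℂ :=
  ∑' l : ℤ,
    let n : ℝ := j + 1 / 2 + (2 * m + 1) * l
    (-1 : ℂ) ^ ((2 * (m : ℤ) + 1) * l)
      * ((Real.sign n
          - errE ((n + (2 * m + 1) * (v.im / τ.im)) * Real.sqrt (τ.im / (m + 1 / 2))) : ℝ) : ℂ)
      * Complex.exp (-(Real.pi * Complex.I * n ^ 2 * τ / (2 * m + 1))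
          - 2 * Real.pi * Complex.I * n * v)

/-- The correction term `Φ^{[B;m]}_add`. -/
noncomputable def phiAdd (m : ℕ) (τ z₁ z₂ t : ℂ) : ℂ :=
  1 / 2 * Complex.exp (2 * Real.pi * Complex.I * (m + 1 / 2) * t) *
    ∑ j ∈ Finset.range (2 * m + 1),
      zwegersR m j τ ((z₁ - z₂) / 2) *
        (thetaMinus (j + 1 / 2) (m + 1 / 2) τ (z₁ + z₂)
          + thetaMinus (-(j + 1 / 2)) (m + 1 / 2) τ (z₁ + z₂))

/-- The modification `Φ̃^{[B;m]} = Φ^{[B;m]} + Φ^{[B;m]}_add`. -/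
noncomputable def phiMod (m : ℕ) (τ z₁ z₂ t : ℂ) : ℂ :=
  phi m τ z₁ z₂ t + phiAdd m τ z₁ z₂ t

/-- The function `Ψ̃^{[B;M,m;ε]}_{a,b;ε'}`. (It depends on `ε'` only through the condition
`a, b ∈ ε' + ℤ`.) -/
noncomputable def psiMod (M m : ℕ) (ε a b : ℝ) (τ z₁ z₂ t : ℂ) : ℂ :=
  qPow τ ((2 * m + 1) / (2 * M) * a * b)
    * Complex.exp (2 * Real.pi * Complex.I * (2 * m + 1) / (2 * M) * (b * z₁ + a * z₂))
    * phiMod m (M * τ) (z₁ + a * τ + ε) (z₂ + b * τ + ε) (t / M)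

/-- Jacobi's theta functions
`ϑ_{ab}(τ, z) = ∑_{n ∈ ℤ} exp (π i τ (n + a/2)² + 2 π i (n + a/2) (z + b/2))`, `a, b = 0, 1`. -/
noncomputable def jacobiTheta (a b : ℝ) (τ z : ℂ) : ℂ :=
  ∑' n : ℤ, Complex.exp (Real.pi * Complex.I * τ * (n + a / 2) ^ 2
    + 2 * Real.pi * Complex.I * (n + a / 2) * (z + b / 2))

/-- The untwisted (`ε' = 0`) and twisted (`ε' = 1/2`) normalized denominator (`ε = 1/2`) and
superdenominator (`ε = 0`) `R̂^{(ε)}_{ε'}` of the affine Lie superalgebra of `osp(3|2)`.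
(The sign convention for `ϑ₁₁` affects only the overall sign of the case `ε = ε' = 0`.) -/
noncomputable def denominator (ε ε' : ℝ) (τ z₁ z₂ t : ℂ) : ℂ :=
  Complex.exp (Real.pi * Complex.I / 2 * (2 * (ε - ε') - 4 * ε * ε' - 1))
    * Complex.exp (Real.pi * Complex.I * t)
    * (ModularForm.eta τ ^ 3
        * jacobiTheta 1 1 τ (z₁ + z₂) * jacobiTheta 1 1 τ ((z₁ - z₂) / 2)
        / (jacobiTheta (1 - 2 * ε') (1 - 2 * ε) τ z₁
          * jacobiTheta (1 - 2 * ε') (1 - 2 * ε) τ z₂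
          * jacobiTheta (1 - 2 * ε') (1 - 2 * ε) τ ((z₁ + z₂) / 2)))

/-- The modified normalized character (`ε = 1/2`, `ε' = 0`), supercharacter (`ε = ε' = 0`),
twisted character (`ε = ε' = 1/2`) and twisted supercharacter (`ε = 0`, `ε' = 1/2`)
`ch̃^{[B;M,m;ε]}_{j,k;ε'}`, for `j, k ∈ ε' + ℤ`, so that the exponent `j - ε'` is an integer.

All poles of `psiMod` lie on zeros of the theta functions in the denominator of `denominator`.
So where a pole of either function or a zero of `denominator` is met, the value of this function
is `0`, by the convention `x / 0 = 0`; elsewhere it is the value of the quotient. -/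
noncomputable def chMod (M m : ℕ) (ε ε' j k : ℝ) (τ z₁ z₂ t : ℂ) : ℂ :=
  (-1 : ℂ) ^ ((j - ε' : ℝ) : ℂ) * (psiMod M m ε j k τ z₁ z₂ t / denominator ε ε' τ z₁ z₂ t)

/-- The index set `Ω^{[B;M;ε]}`, for `ε = 0` or `1/2`; see `mem_omega`. -/
noncomputable def omega (M : ℕ) (ε : ℝ) : Finset (ℝ × ℝ) :=
  open Classical in
  ((Finset.Ico (-(M : ℤ)) M ×ˢ Finset.Ico (0 : ℤ) M).filter (fun p => (2 : ℤ) ∣ p.1 - p.2)).image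
    (fun p => (ε + p.1, ε + p.2))

/-- `Ω^{[B;M;ε]} = {(j, k) ∈ (ε + ℤ)² | -M ≤ j < M, 0 ≤ k < M, j ≡ k mod 2}`. -/
theorem mem_omega (M : ℕ) (ε : ℝ) (hε : ε = 0 ∨ ε = 1 / 2) (j k : ℝ) :
    (j, k) ∈ omega M ε ↔
      (∃ a : ℤ, j = ε + a) ∧ (∃ b : ℤ, k = ε + b) ∧ (-(M : ℝ) ≤ j ∧ j < M) ∧
        (0 ≤ k ∧ k < M) ∧ ∃ c : ℤ, j - k = 2 * c := by
  have h0 : 0 ≤ ε ∧ ε < 1 := by rcases hε with h | h <;> rw [h] <;> norm_num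
  have lo : ∀ x y : ℤ, (x : ℝ) ≤ ε + y ↔ x ≤ y := by
    intro x y
    constructor
    · intro h
      have : (x : ℝ) < ((y + 1 : ℤ) : ℝ) := by push_cast; linarith [h0.2]
      have := Int.cast_lt.1 this
      omega
    · intro h
      have : (x : ℝ) ≤ y := by exact_mod_cast h
      linarith [h0.1]
  have hi : ∀ x y : ℤ, ε + (y : ℝ) < x ↔ y < x := by
    intro x y
    rw [← not_le, ← not_le, lo]
  simp only [omega, Finset.mem_image, Finset.mem_filter, Finset.mem_product, Finset.mem_Ico,
    Prod.mk.injEq, Prod.exists]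
  have eM : (M : ℝ) = ((M : ℤ) : ℝ) := by simp
  have eM' : -((M : ℤ) : ℝ) = ((-(M : ℤ) : ℤ) : ℝ) := by simp
  have e0 : (0 : ℝ) = ((0 : ℤ) : ℝ) := by simp
  constructor
  · rintro ⟨a, b, ⟨⟨⟨h1, h2⟩, h3, h4⟩, c, hc⟩, rfl, rfl⟩
    refine ⟨⟨a, rfl⟩, ⟨b, rfl⟩, ⟨?_, ?_⟩, ⟨?_, ?_⟩, c, ?_⟩
    · rw [eM, eM', lo]; exact h1
    · rw [eM, hi]; exact h2
    · rw [e0, lo]; exact h3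
    · rw [eM, hi]; exact h4
    · have : (a : ℝ) - b = 2 * c := by exact_mod_cast hc
      linarith
  · rintro ⟨⟨a, rfl⟩, ⟨b, rfl⟩, ⟨h1, h2⟩, ⟨h3, h4⟩, c, hc⟩
    rw [eM, eM', lo] at h1
    rw [eM, hi] at h2
    rw [e0, lo] at h3
    rw [eM, hi] at h4
    refine ⟨a, b, ⟨⟨⟨h1, h2⟩, h3, h4⟩, c, ?_⟩, rfl, rfl⟩
    have : (a : ℝ) - b = 2 * c := by linarith
    exact_mod_cast this

/-- The domain `X = {(τ, z₁, z₂, t) | Im τ > 0}`. -/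
abbrev Domain : Type := UpperHalfPlane × ℂ × ℂ × ℂ

/-- The action of `SL₂(ℤ)` on functions on `X`:
`(F|_A)(τ, z₁, z₂, t) =
  F ((aτ+b)/(cτ+d), z₁/(cτ+d), z₂/(cτ+d), t - c (z|z) / (2 (cτ+d)))`, where `(z|z) = 2 z₁ z₂`. -/
noncomputable def act (A : Matrix.SpecialLinearGroup (Fin 2) ℤ) (F : Domain → ℂ) : Domain → ℂ :=
  fun h =>
    let w : ℂ := (A 1 0 : ℂ) * (h.1 : ℂ) + (A 1 1 : ℂ)
    F (A • h.1, h.2.1 / w, h.2.2.1 / w,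
      h.2.2.2 - (A 1 0 : ℂ) * (2 * h.2.1 * h.2.2.1) / (2 * w))

/-- The family of all functions `ch̃^{[B;M,m;ε]}_{j,k;ε'}` on `X`, where `ε, ε' ∈ {0, 1/2}` and
`(j, k) ∈ Ω^{[B;M;ε']}`. -/
def family (M m : ℕ) : Set (Domain → ℂ) :=
  {F | ∃ ε ε' j k : ℝ, (ε = 0 ∨ ε = 1 / 2) ∧ (ε' = 0 ∨ ε' = 1 / 2) ∧ (j, k) ∈ omega M ε' ∧
    F = fun h => chMod M m ε ε' j k (h.1 : ℂ) h.2.1 h.2.2.1 h.2.2.2}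

end OspModular

namespace OspModular

open Complex
open scoped Real ComplexConjugate MatrixGroups

/-! The completed numerator is a difference of two non-holomorphic lattice sums whose modular
behaviour is visible term by term. Up to elementary factors, the completion of `phiOne` is the sum
over `p = z₁ + cτ + d` of a sign `(-1)^(cd+c+d)` times a Gaussian in `|p|²` times a phase, divided
by `p`. The Gaussian makes the double sum absolutely convergent, so it can be rearranged freely.

To see this, fix `c` and sum over `d`. Multiplying by `exp(2πiX) - 1` with `X = z₁ + cτ` turns each
`1/p` into an integral over an interval of length one; Poisson summation and the fundamental theorem
then give differences of error functions, and an index shift recovers the Appell summand plus half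
an error function series (`tsum_gaussTerm_div`). Summed over `c`, the error function series are
exactly the products of `zwegersR` and `thetaMinus` in `phiAdd` (`tsum_phiOneTerm_add`,
`phiMod_eq_latticeSeries`). Substituting the shifted arguments gives `halfPsi`, a sum over a coset
of the lattice `ℤMτ + ℤ` weighted by a unimodular character.

Under `τ ↦ -1/τ` the kernel is homogeneous (`kernel_div`). Summing over `Ω` fills in all multiples
of `τ`, while orthogonality of characters of `ZMod M` keeps only one class modulo `M` in the other
direction (`halfPsi_neg_inv`); coprimality of `M` and `4m+2` enters here. Under `τ ↦ τ + 1` the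
lattice is sheared (`halfPsi_add_one`). The denominators transform by the laws of theta and eta, and
they take the value `0` at every pole of the numerator, so the convention `x / 0 = 0` is respected
on both sides. Invariance of the span follows because `S` and `T` generate `SL(2, ℤ)`. -/

/-! ### Gaussian series and the error function. -/

theorem summable_exp_quadratic {a : ℝ} (ha : 0 < a) (b c : ℝ) :
    Summable fun k : ℤ => Real.exp (-a * k ^ 2 + b * k + c) := by
  have h := (summable_jacobiTheta₂_term_iff (-(b / (2 * π) : ℝ) * I) ((a / π : ℝ) * I)).2
    (by rw [mul_I_im, ofReal_re]; positivity)
  refine (h.norm.mul_right (Real.exp c)).congr fun k => ?_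
  rw [norm_jacobiTheta₂_term, ← Real.exp_add]
  congr 1
  rw [← ofReal_neg, mul_I_im, mul_I_im, ofReal_re, ofReal_re]
  field_simp
  ring

/-- Poisson summation; the alternating sign is a character of order two and moves the dual
frequencies to half-integers. -/
theorem tsum_alternating_gaussian {κ : ℝ} (hκ : 0 < κ) (β : ℝ) (X : ℂ) :
    ∑' d : ℤ, (-1 : ℂ) ^ d * cexp (-π * (X + d) ^ 2 / κ ^ 2 + 2 * π * I * β * (X + d)) =
      κ * ∑' k : ℤ, cexp (-π * κ ^ 2 * (k + 1 / 2 - β) ^ 2) * cexp (2 * π * I * (k + 1 / 2) * X) := by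
  have hκ' : (κ : ℂ) ≠ 0 := by exact_mod_cast hκ.ne'
  have h := Complex.tsum_exp_neg_quadratic (a := ((κ ^ 2)⁻¹ : ℝ)) (by rw [ofReal_re]; positivity)
    (-X / κ ^ 2 + I * β - I / 2)
  have e : ((((κ ^ 2)⁻¹ : ℝ) : ℂ)) ^ (1 / 2 : ℂ) = (κ : ℂ)⁻¹ := by
    rw [show ((κ ^ 2)⁻¹ : ℝ) = (κ⁻¹) ^ 2 by simp, show (1 / 2 : ℂ) = ((1 / 2 : ℝ) : ℂ) by simp,
      ← Complex.ofReal_cpow (by positivity), ← Real.sqrt_eq_rpow, Real.sqrt_sq (by positivity)]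
    simp
  rw [e] at h
  have e1 : ∀ d : ℤ, (-1 : ℂ) ^ d = cexp (-(π * I * d)) := by
    intro d
    rw [show -(π * I * d) = ((d : ℤ) : ℂ) * (-(π * I)) by ring, Complex.exp_int_mul, Complex.exp_neg,
      Complex.exp_pi_mul_I]
    norm_num
  calc _ = cexp (-π * X ^ 2 / κ ^ 2 + 2 * π * I * β * X) * ∑' n : ℤ,
        cexp (-π * ((κ ^ 2)⁻¹ : ℝ) * n ^ 2 + 2 * π * (-X / κ ^ 2 + I * β - I / 2) * n) := by
        rw [← tsum_mul_left]
        refine tsum_congr fun d => ?_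
        rw [e1, ← Complex.exp_add, ← Complex.exp_add]
        congr 1
        push_cast
        ring
    _ = _ := by
        rw [h, mul_left_comm]
        congr 1
        · simp
        rw [← tsum_mul_left]
        refine tsum_congr fun d => ?_
        rw [← Complex.exp_add, ← Complex.exp_add]
        congr 1
        push_cast
        field_simp
        ring_nf
        simp only [I_sq, show I ^ 3 = -I by rw [pow_succ, I_sq]; ring, I_pow_four]
        ring

theorem errE_neg (x : ℝ) : errE (-x) = -errE x := by
  unfold errE
  have := intervalIntegral.integral_comp_neg (a := 0) (b := x)
    (fun u : ℝ => Real.exp (-π * u ^ 2))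
  simp only [neg_zero, neg_sq] at this
  rw [intervalIntegral.integral_symm, ← this]
  ring

theorem integral_gaussian_pi_Ioi : 2 * ∫ u in Set.Ioi (0 : ℝ), Real.exp (-π * u ^ 2) = 1 := by
  rw [integral_gaussian_Ioi, div_self Real.pi_ne_zero]
  simp

theorem one_sub_errE (x : ℝ) : 1 - errE x = 2 * ∫ u in Set.Ioi x, Real.exp (-π * u ^ 2) := by
  have hi : MeasureTheory.Integrable fun u : ℝ => Real.exp (-π * u ^ 2) :=
    integrable_exp_neg_mul_sq Real.pi_pos
  have := intervalIntegral.integral_interval_add_Ioi (a := 0) (b := x)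
    (f := fun u : ℝ => Real.exp (-π * u ^ 2)) hi.integrableOn hi.integrableOn
  rw [errE, ← integral_gaussian_pi_Ioi, ← this]
  ring

theorem abs_errE_sub_one_le {x : ℝ} (hx : 0 ≤ x) : |errE x - 1| ≤ Real.exp (-π * x ^ 2) := by
  have hi : MeasureTheory.Integrable fun u : ℝ => Real.exp (-π * u ^ 2) :=
    integrable_exp_neg_mul_sq Real.pi_pos
  have h1 : errE x - 1 = -(2 * ∫ u in Set.Ioi x, Real.exp (-π * u ^ 2)) := by
    linarith [one_sub_errE x]
  have h2 : ∫ u in Set.Ioi x, Real.exp (-π * u ^ 2) = ∫ u in Set.Ioi (0 : ℝ), Real.exp (-π * (u + x) ^ 2) := by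
    rw [← (MeasureTheory.measurePreserving_add_right MeasureTheory.volume x).setIntegral_preimage_emb
      (measurableEmbedding_addRight x)]
    simp
  have h3 : ∫ u in Set.Ioi (0 : ℝ), Real.exp (-π * (u + x) ^ 2) ≤
      ∫ u in Set.Ioi (0 : ℝ), Real.exp (-π * x ^ 2) * Real.exp (-π * u ^ 2) := by
    refine MeasureTheory.setIntegral_mono_on (hi.comp_add_right x).integrableOn (hi.const_mul _).integrableOn
      measurableSet_Ioi fun u hu => ?_
    rw [← Real.exp_add]
    apply Real.exp_le_exp.2
    have : 0 ≤ π * (u * x) := by have := Set.mem_Ioi.1 hu; positivity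
    nlinarith
  rw [MeasureTheory.integral_const_mul] at h3
  have h4 : 0 ≤ ∫ u in Set.Ioi x, Real.exp (-π * u ^ 2) :=
    MeasureTheory.integral_nonneg fun _ => (Real.exp_pos _).le
  rw [h1, abs_neg, abs_of_nonneg (by positivity), h2]
  nlinarith [integral_gaussian_pi_Ioi]

theorem abs_errE_le_one (x : ℝ) : |errE x| ≤ 1 := by
  have main : ∀ x : ℝ, 0 ≤ x → |errE x| ≤ 1 := by
    intro x hx
    have h0 : 0 ≤ ∫ u in Set.Ioi x, Real.exp (-π * u ^ 2) :=
      MeasureTheory.integral_nonneg fun _ => (Real.exp_pos _).le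
    have h1 : 0 ≤ ∫ u in (0 : ℝ)..x, Real.exp (-π * u ^ 2) :=
      intervalIntegral.integral_nonneg hx fun u _ => (Real.exp_pos _).le
    have h2 := one_sub_errE x
    rw [abs_le]
    constructor
    · unfold errE; linarith
    · linarith
  rcases le_total 0 x with h | h
  · exact main x h
  · rw [← abs_neg, ← errE_neg]
    exact main _ (by linarith)

/-- When `s` and `s - β` have the same sign this is the Gaussian tail bound. Otherwise `s` lies
between `0` and `β`, so `|s - β| ≤ |β|`, the two exponentials multiply to at least `1`, and the
trivial bound `2` suffices. -/
theorem abs_errE_sub_sign_le {κ : ℝ} (hκ : 0 < κ) (β : ℝ) {s : ℝ} (hs : s ≠ 0) :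
    |errE ((s - β) * κ) - Real.sign s| ≤
      2 * Real.exp (π * κ ^ 2 * β ^ 2) * Real.exp (-π * κ ^ 2 * (s - β) ^ 2) := by
  have main : ∀ β s : ℝ, 0 < s → |errE ((s - β) * κ) - 1| ≤
      2 * Real.exp (π * κ ^ 2 * β ^ 2) * Real.exp (-π * κ ^ 2 * (s - β) ^ 2) := by
    intro β s hs
    have e1 : (1 : ℝ) ≤ Real.exp (π * κ ^ 2 * β ^ 2) := Real.one_le_exp (by positivity)
    rcases le_or_gt 0 (s - β) with h | h
    · refine (abs_errE_sub_one_le (by positivity)).trans ?_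
      rw [show -π * ((s - β) * κ) ^ 2 = -π * κ ^ 2 * (s - β) ^ 2 by ring]
      have := Real.exp_pos (-π * κ ^ 2 * (s - β) ^ 2)
      nlinarith
    · have h1 := abs_errE_sub_one_le (x := -((s - β) * κ)) (by nlinarith)
      rw [errE_neg] at h1
      have h2 : Real.exp (-π * (-((s - β) * κ)) ^ 2) ≤ 1 :=
        Real.exp_le_one_iff.2 (by have : 0 ≤ π * (-((s - β) * κ)) ^ 2 := by positivity
                                  linarith)
      rw [show -π * (-((s - β) * κ)) ^ 2 = -π * κ ^ 2 * (s - β) ^ 2 by ring] at h1 h2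
      have h3 : 1 ≤ Real.exp (π * κ ^ 2 * β ^ 2) * Real.exp (-π * κ ^ 2 * (s - β) ^ 2) := by
        rw [← Real.exp_add]
        apply Real.one_le_exp
        have : 0 ≤ π * κ ^ 2 * (s * (2 * β - s)) := by
          have : 0 < 2 * β - s := by linarith
          positivity
        nlinarith
      rw [abs_le] at h1 ⊢
      have h0 : errE ((s - β) * κ) ≤ 0 := by
        rw [← neg_neg ((s - β) * κ), errE_neg]
        have : 0 ≤ errE (-((s - β) * κ)) := by
          unfold errE
          have := intervalIntegral.integral_nonneg (μ := MeasureTheory.volume)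
            (f := fun u : ℝ => Real.exp (-π * u ^ 2)) (a := 0) (b := -((s - β) * κ)) (by nlinarith)
            (fun u _ => (Real.exp_pos _).le)
          positivity
        linarith
      constructor <;> linarith [h1.1, h1.2, abs_le.1 (abs_errE_le_one ((s - β) * κ))]
  rcases lt_or_gt_of_ne hs with h | h
  · have := main (-β) (-s) (by linarith)
    rw [Real.sign_of_neg h]
    rw [show (-s - -β) * κ = -((s - β) * κ) by ring, errE_neg, show (-s - -β) ^ 2 = (s - β) ^ 2 by ring,
      neg_sq, ← abs_neg] at this
    rwa [show -(-errE ((s - β) * κ) - 1) = errE ((s - β) * κ) - -1 by ring] at this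
  · rw [Real.sign_of_pos h]
    exact main β s h

theorem errE_sub_errE (κ β s : ℝ) :
    errE ((s - β) * κ) - errE ((s - 1 - β) * κ) =
      2 * κ * ∫ b in β..(β + 1), Real.exp (-π * κ ^ 2 * (s - b) ^ 2) := by
  have hi : ∀ a b : ℝ, IntervalIntegrable (fun u : ℝ => Real.exp (-π * u ^ 2)) MeasureTheory.volume a b :=
    fun a b => Continuous.intervalIntegrable (by fun_prop) _ _
  have h := intervalIntegral.smul_integral_comp_sub_mul (a := β) (b := β + 1)
    (fun u : ℝ => Real.exp (-π * u ^ 2)) κ (κ * s)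
  rw [errE, errE, ← mul_sub, intervalIntegral.integral_interval_sub_left (hi _ _) (hi _ _), mul_assoc]
  congr 1
  rw [show (s - β) * κ = κ * s - κ * β by ring, show (s - 1 - β) * κ = κ * s - κ * (β + 1) by ring, ← h,
    smul_eq_mul]
  congr 1
  refine intervalIntegral.integral_congr fun b _ => ?_
  congr 1
  ring

/-! ### One row of the lattice sum: from `1/p` to error functions. -/

/-- The Gaussian summand whose alternating sum over `d` is dual to the error function series. -/
noncomputable def gaussTerm (κ β : ℝ) (p : ℂ) : ℂ := cexp (-π * p ^ 2 / κ ^ 2 + 2 * π * I * β * p)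

/-- The summand of the error function series. -/
noncomputable def errTerm (κ β : ℝ) (X : ℂ) (k : ℤ) : ℂ :=
  ((errE ((k + 1 / 2 - β) * κ) - Real.sign (k + 1 / 2) : ℝ) : ℂ) * cexp (2 * π * I * (k + 1 / 2) * X)

theorem int_add_half_ne_zero (k : ℤ) : (k + 1 / 2 : ℝ) ≠ 0 := by
  intro h
  have : (2 * k + 1 : ℝ) = 0 := by linarith
  have : (2 * k + 1 : ℤ) = 0 := by exact_mod_cast this
  omega

theorem norm_exp_half_int (k : ℤ) (X : ℂ) :
    ‖cexp (2 * π * I * (k + 1 / 2) * X)‖ = Real.exp (-2 * π * (k + 1 / 2) * X.im) := by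
  rw [Complex.norm_exp]
  congr 1
  rw [show 2 * π * I * (k + 1 / 2) * X = ((2 * π * (k + 1 / 2) : ℝ) : ℂ) * X * I by push_cast; ring]
  rw [mul_I_re, im_ofReal_mul]
  ring

theorem norm_errTerm_le {κ : ℝ} (hκ : 0 < κ) (β : ℝ) (X : ℂ) (k : ℤ) :
    ‖errTerm κ β X k‖ ≤ 2 * Real.exp (π * κ ^ 2 * β ^ 2) *
      Real.exp (-π * κ ^ 2 * (k + 1 / 2 - β) ^ 2) * Real.exp (-2 * π * (k + 1 / 2) * X.im) := by
  rw [errTerm, norm_mul, norm_exp_half_int, norm_real]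
  gcongr
  exact abs_errE_sub_sign_le hκ β (int_add_half_ne_zero k)

theorem summable_errTerm {κ : ℝ} (hκ : 0 < κ) (β : ℝ) (X : ℂ) : Summable (errTerm κ β X) := by
  have h := (summable_exp_quadratic (a := π * κ ^ 2) (by positivity)
    (-2 * π * κ ^ 2 * (1 / 2 - β) - 2 * π * X.im)
    (-π * κ ^ 2 * (1 / 2 - β) ^ 2 - π * X.im)).mul_left (2 * Real.exp (π * κ ^ 2 * β ^ 2))
  refine .of_norm_bounded h fun k => (norm_errTerm_le hκ β X k).trans_eq ?_
  rw [mul_assoc, ← Real.exp_add]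
  ring_nf

theorem norm_gaussTerm_add_int (κ b : ℝ) (X : ℂ) (d : ℤ) :
    ‖gaussTerm κ b (X + d)‖ =
      Real.exp (-(π / κ ^ 2) * d ^ 2 + (-2 * (π / κ ^ 2) * X.re) * d +
        (-(π / κ ^ 2) * (X.re ^ 2 - X.im ^ 2) - 2 * π * b * X.im)) := by
  rw [gaussTerm, Complex.norm_exp]
  congr 1
  rw [show -π * (X + d) ^ 2 / κ ^ 2 + 2 * π * I * b * (X + d) =
    ((-(π / κ ^ 2) : ℝ) : ℂ) * (X + d) ^ 2 + ((2 * π * b : ℝ) : ℂ) * (X + d) * I by push_cast; ring]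
  rw [add_re, re_ofReal_mul, mul_I_re, im_ofReal_mul, sq (X + d), mul_re]
  simp
  ring

theorem hasSum_integral_gaussTerm {κ : ℝ} (hκ : 0 < κ) (β : ℝ) (X : ℂ) :
    HasSum (fun d : ℤ => ∫ b in β..(β + 1), (-1 : ℂ) ^ d * gaussTerm κ b (X + d))
      (∫ b in β..(β + 1), ∑' d : ℤ, (-1 : ℂ) ^ d * gaussTerm κ b (X + d)) := by
  let f : ℤ → C(ℝ, ℂ) := fun d =>
    ⟨fun b => (-1 : ℂ) ^ d * gaussTerm κ b (X + d), by unfold gaussTerm; fun_prop⟩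
  refine intervalIntegral.hasSum_intervalIntegral_of_summable_norm (f := f) ?_
  have h := (summable_exp_quadratic (a := π / κ ^ 2) (by positivity) (-2 * (π / κ ^ 2) * X.re)
    (-(π / κ ^ 2) * (X.re ^ 2 - X.im ^ 2) + 2 * π * (|β| + 1) * |X.im|))
  refine .of_nonneg_of_le (fun d => norm_nonneg _) (fun d => ?_) h
  refine (ContinuousMap.norm_le _ (Real.exp_pos _).le).2 fun ⟨b, hb⟩ => ?_
  change ‖(-1 : ℂ) ^ d * gaussTerm κ b (X + d)‖ ≤ _
  rw [norm_mul, norm_zpow, norm_neg, norm_one, one_zpow, one_mul, norm_gaussTerm_add_int]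
  apply Real.exp_le_exp.2
  change b ∈ Set.uIcc β (β + 1) at hb
  rw [Set.uIcc_of_le (by linarith)] at hb
  have hb' : |b| ≤ |β| + 1 := by
    rw [abs_le]
    constructor <;> linarith [hb.1, hb.2, neg_abs_le β, le_abs_self β]
  have : -(b * X.im) ≤ (|β| + 1) * |X.im| := by
    calc -(b * X.im) ≤ |b * X.im| := neg_le_abs _
      _ = |b| * |X.im| := abs_mul _ _
      _ ≤ _ := by gcongr
  nlinarith [Real.pi_pos]

theorem hasSum_integral_gauss_half_int {κ : ℝ} (hκ : 0 < κ) (β : ℝ) (X : ℂ) :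
    HasSum (fun k : ℤ => ∫ b in β..(β + 1),
        cexp (-π * κ ^ 2 * (k + 1 / 2 - b) ^ 2) * cexp (2 * π * I * (k + 1 / 2) * X))
      (∫ b in β..(β + 1), ∑' k : ℤ,
        cexp (-π * κ ^ 2 * (k + 1 / 2 - b) ^ 2) * cexp (2 * π * I * (k + 1 / 2) * X)) := by
  let f : ℤ → C(ℝ, ℂ) := fun k =>
    ⟨fun b => cexp (-π * κ ^ 2 * (k + 1 / 2 - b) ^ 2) * cexp (2 * π * I * (k + 1 / 2) * X),
      by fun_prop⟩
  refine intervalIntegral.hasSum_intervalIntegral_of_summable_norm (f := f) ?_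
  have h := (summable_exp_quadratic (a := π * κ ^ 2 / 2) (by positivity)
    (- π * κ ^ 2 * (1 / 2 - β) - 2 * π * X.im)
    (-π * κ ^ 2 / 2 * (1 / 2 - β) ^ 2 + π * κ ^ 2 - π * X.im))
  refine .of_nonneg_of_le (fun d => norm_nonneg _) (fun k => ?_) h
  refine (ContinuousMap.norm_le _ (Real.exp_pos _).le).2 fun ⟨b, hb⟩ => ?_
  change ‖cexp (-π * κ ^ 2 * (k + 1 / 2 - b) ^ 2) * cexp (2 * π * I * (k + 1 / 2) * X)‖ ≤ _
  change b ∈ Set.uIcc β (β + 1) at hb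
  rw [Set.uIcc_of_le (by linarith)] at hb
  rw [norm_mul, norm_exp_half_int, show -π * κ ^ 2 * (k + 1 / 2 - b) ^ 2 =
    ((-π * κ ^ 2 * (k + 1 / 2 - b) ^ 2 : ℝ) : ℂ) by push_cast; ring, ← ofReal_exp, norm_real,
    Real.norm_of_nonneg (Real.exp_pos _).le, ← Real.exp_add]
  apply Real.exp_le_exp.2
  -- As `b` stays within distance `1` of `β`, half of the Gaussian decay can be kept uniformly in
  -- `b`.
  have h1 : (b - β) ^ 2 ≤ 1 := by nlinarith [hb.1, hb.2]
  have h2 : (1 / 2) * (k + 1 / 2 - β) ^ 2 - 1 ≤ (k + 1 / 2 - b) ^ 2 := by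
    nlinarith [sq_nonneg ((k + 1 / 2 - β) - 2 * (b - β))]
  have h3 := mul_le_mul_of_nonneg_left h2 (show 0 ≤ π * κ ^ 2 by positivity)
  nlinarith

theorem integral_gauss_half_int (κ β : ℝ) (X : ℂ) (k : ℤ) :
    κ * ∫ b in β..(β + 1), cexp (-π * κ ^ 2 * (k + 1 / 2 - b) ^ 2) * cexp (2 * π * I * (k + 1 / 2) * X) =
      1 / 2 * ((errE ((k + 1 / 2 - β) * κ) - errE ((k + 1 / 2 - 1 - β) * κ) : ℝ) : ℂ)
        * cexp (2 * π * I * (k + 1 / 2) * X) := by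
  rw [intervalIntegral.integral_mul_const, errE_sub_errE]
  have : ∫ b in β..(β + 1), cexp (-π * κ ^ 2 * (k + 1 / 2 - b) ^ 2) =
      ((∫ b in β..(β + 1), Real.exp (-π * κ ^ 2 * (k + 1 / 2 - b) ^ 2) : ℝ) : ℂ) := by
    rw [← intervalIntegral.integral_ofReal]
    push_cast
    rfl
  rw [this]
  push_cast
  ring

theorem exp_two_pi_I_ne_one {X : ℂ} (hX : ∀ d : ℤ, X + d ≠ 0) : cexp (2 * π * I * X) ≠ 1 := by
  rw [Ne, Complex.exp_eq_one_iff]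
  rintro ⟨n, hn⟩
  apply hX (-n)
  have : X = n := by
    have h : (2 * π * I : ℂ) ≠ 0 := by simp [Real.pi_ne_zero]
    apply mul_left_cancel₀ h
    rw [hn]; ring
  rw [this]; push_cast; ring

/-- The factor `exp(2πiX) - 1` does not depend on `d` and equals the relative increment of
`exp(2πib(X+d))` from `b = β` to `b = β + 1`, so the pole is replaced by an integral for all `d` at
once. -/
theorem exp_sub_one_mul_gaussTerm_div (κ β : ℝ) (X : ℂ) (d : ℤ) (hX : X + d ≠ 0) :
    (cexp (2 * π * I * X) - 1) * (gaussTerm κ β (X + d) / (X + d)) =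
      2 * π * I * ∫ b in β..(β + 1), gaussTerm κ b (X + d) := by
  have hc : 2 * π * I * (X + d) ≠ 0 := by simp [Real.pi_ne_zero, hX]
  have e1 : ∀ b : ℝ, gaussTerm κ b (X + d) =
      cexp (-π * (X + d) ^ 2 / κ ^ 2) * cexp (2 * π * I * (X + d) * b) := by
    intro b
    rw [gaussTerm, ← Complex.exp_add]
    congr 1; ring
  have e2 : cexp (2 * π * I * (X + d) * (β + 1 : ℝ)) =
      cexp (2 * π * I * (X + d) * β) * cexp (2 * π * I * X) := by
    rw [show 2 * π * I * (X + d) * (β + 1 : ℝ) =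
      2 * π * I * (X + d) * β + 2 * π * I * X + d * (2 * π * I) by push_cast; ring,
      Complex.exp_add, Complex.exp_add, exp_int_mul_two_pi_mul_I, mul_one]
  simp_rw [e1]
  rw [intervalIntegral.integral_const_mul, integral_exp_mul_complex hc, e2]
  field_simp

/-- Summation by parts. Subtracting the sign makes the two shifted series converge separately; the
sign jumps only between `-1/2` and `1/2`, and this jump at `k = 0` produces the term `2 exp(πiX)`,
the source of the Appell summand. -/
theorem tsum_errE_sub {κ : ℝ} (hκ : 0 < κ) (β : ℝ) (X : ℂ) :
    ∑' k : ℤ, ((errE ((k + 1 / 2 - β) * κ) - errE ((k + 1 / 2 - 1 - β) * κ) : ℝ) : ℂ)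
        * cexp (2 * π * I * (k + 1 / 2) * X) =
      (1 - cexp (2 * π * I * X)) * ∑' k, errTerm κ β X k + 2 * cexp (π * I * X) := by
  have hs := summable_errTerm hκ β X
  have hs' : HasSum (fun k : ℤ => errTerm κ β X (k - 1)) (∑' k, errTerm κ β X k) :=
    (Equiv.subRight (1 : ℤ)).hasSum_iff.2 hs.hasSum
  have h0 : HasSum (fun k : ℤ => if k = 0 then 2 * cexp (π * I * X) else 0)
      (2 * cexp (π * I * X)) := by
    simpa using hasSum_ite_eq (0 : ℤ) (2 * cexp (π * I * X))
  have h := (hs.hasSum.sub (hs'.mul_left (cexp (2 * π * I * X)))).add h0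
  rw [show (1 - cexp (2 * π * I * X)) * ∑' k, errTerm κ β X k + 2 * cexp (π * I * X) = _ from
    (by ring : _ = ∑' k, errTerm κ β X k - cexp (2 * π * I * X) * ∑' k, errTerm κ β X k
      + 2 * cexp (π * I * X)), ← h.tsum_eq]
  refine tsum_congr fun k => ?_
  have e : cexp (2 * π * I * X) * cexp (2 * π * I * ((k - 1 : ℤ) + 1 / 2) * X) =
      cexp (2 * π * I * (k + 1 / 2) * X) := by
    rw [← Complex.exp_add]; congr 1; push_cast; ring
  rw [errTerm, errTerm, mul_left_comm (cexp (2 * π * I * X)), e]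
  have e3 : ((k - 1 : ℤ) + 1 / 2 : ℝ) = k + 1 / 2 - 1 := by push_cast; ring
  rw [e3]
  by_cases hk : k = 0
  · subst hk
    have s1 : Real.sign ((0 : ℤ) + 1 / 2) = 1 := Real.sign_of_pos (by norm_num)
    have s2 : Real.sign ((0 : ℤ) + 1 / 2 - 1) = -1 := Real.sign_of_neg (by norm_num)
    rw [s1, s2, if_pos rfl, show (2 * π * I * ((0 : ℤ) + 1 / 2) * X : ℂ) = π * I * X by push_cast; ring]
    push_cast
    ring
  · have s : Real.sign (k + 1 / 2 - 1) = Real.sign (k + 1 / 2) := by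
      rcases lt_or_gt_of_ne hk with h | h
      · have : (k : ℝ) ≤ -1 := by exact_mod_cast (by omega : k ≤ -1)
        rw [Real.sign_of_neg (by linarith), Real.sign_of_neg (by linarith)]
      · have : (1 : ℝ) ≤ k := by exact_mod_cast (by omega : 1 ≤ k)
        rw [Real.sign_of_pos (by linarith), Real.sign_of_pos (by linarith)]
    rw [s, if_neg hk]
    push_cast
    ring

theorem tsum_gaussTerm_div {κ : ℝ} (hκ : 0 < κ) (β : ℝ) {X : ℂ} (hX : ∀ d : ℤ, X + d ≠ 0) :
    I / (2 * π) * ∑' d : ℤ, (-1 : ℂ) ^ d * (gaussTerm κ β (X + d) / (X + d)) =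
      cexp (π * I * X) / (1 - cexp (2 * π * I * X)) + 1 / 2 * ∑' k : ℤ, errTerm κ β X k := by
  have hw := exp_two_pi_I_ne_one hX
  set w := cexp (2 * π * I * X) with hwdef
  have hπ : (π : ℂ) ≠ 0 := by exact_mod_cast Real.pi_ne_zero
  have h1 : (w - 1) * ∑' d : ℤ, (-1 : ℂ) ^ d * (gaussTerm κ β (X + d) / (X + d)) =
      2 * π * I * ∫ b in β..(β + 1), ∑' d : ℤ, (-1 : ℂ) ^ d * gaussTerm κ b (X + d) := by
    rw [← (hasSum_integral_gaussTerm hκ β X).tsum_eq, ← tsum_mul_left, ← tsum_mul_left]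
    refine tsum_congr fun d => ?_
    rw [mul_left_comm, exp_sub_one_mul_gaussTerm_div _ _ _ _ (hX d),
      intervalIntegral.integral_const_mul]
    ring
  have h2 : ∫ b in β..(β + 1), ∑' d : ℤ, (-1 : ℂ) ^ d * gaussTerm κ b (X + d) =
      1 / 2 * ((1 - w) * ∑' k, errTerm κ β X k + 2 * cexp (π * I * X)) := by
    simp_rw [gaussTerm, tsum_alternating_gaussian hκ]
    rw [intervalIntegral.integral_const_mul, ← (hasSum_integral_gauss_half_int hκ β X).tsum_eq,
      ← tsum_errE_sub hκ, ← tsum_mul_left, ← tsum_mul_left]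
    refine tsum_congr fun k => ?_
    rw [integral_gauss_half_int]
    ring
  have hw1 : w - 1 ≠ 0 := sub_ne_zero.2 hw
  have hw2 : 1 - w ≠ 0 := sub_ne_zero.2 hw.symm
  rw [h2] at h1
  apply mul_left_cancel₀ hw1
  rw [mul_left_comm, h1]
  field_simp
  rw [I_sq]
  ring

/-! ### The absolutely convergent lattice series. -/

theorem neg_one_zpow_eq_exp (n : ℤ) : (-1 : ℂ) ^ n = cexp (π * I * n) := by
  rw [mul_comm, Complex.exp_int_mul, Complex.exp_pi_mul_I]

theorem neg_exp_eq (x : ℂ) : -cexp x = cexp (π * I + x) := by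
  rw [Complex.exp_add, Complex.exp_pi_mul_I, neg_one_mul]

theorem norm_neg_one_zpow (n : ℤ) : ‖(-1 : ℂ) ^ n‖ = 1 := by simp

theorem summable_norm_add_lattice_inv_pow {τ : ℂ} (hτ : 0 < τ.im) (z : ℂ) :
    Summable fun p : ℤ × ℤ => (‖z + p.1 * τ + p.2‖ ^ 3)⁻¹ := by
  have hind : LinearIndependent ℝ ![τ, 1] := by
    refine LinearIndependent.pair_iff.2 fun s t h => ?_
    have h1 := congrArg Complex.im h
    have h2 := congrArg Complex.re h
    simp at h1 h2
    rcases h1 with h1 | h1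
    · subst h1; simpa using h2
    · exact absurd h1 hτ.ne'
  let L : PeriodPair := ⟨τ, 1, hind⟩
  have h := ZLattice.summable_norm_sub_inv_pow L.lattice 3 (by simp) (-z)
  refine ((L.latticeEquivProd.symm.toEquiv.summable_iff).2 h).congr fun p => ?_
  have e : ((L.latticeEquivProd.symm p : L.lattice) : ℂ) = p.1 * τ + p.2 * 1 :=
    L.latticeEquiv_symm_apply p
  simp only [Function.comp, LinearEquiv.coe_toEquiv, e]
  rw [← inv_pow]
  congr 3
  ring

/-- The summand of the lattice series: a Gaussian times `1 / p`. -/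
noncomputable def kernel (A : ℝ) (z p : ℂ) : ℂ :=
  cexp (-A * (p * conj p + z * conj p - conj z * p)) / p

theorem norm_kernel (A : ℝ) (z p : ℂ) : ‖kernel A z p‖ = Real.exp (-A * ‖p‖ ^ 2) / ‖p‖ := by
  rw [kernel, norm_div, Complex.norm_exp]
  congr 2
  have h1 : p * conj p = ((‖p‖ ^ 2 : ℝ) : ℂ) := by rw [mul_conj, normSq_eq_norm_sq]
  rw [h1, show (-A * (((‖p‖ ^ 2 : ℝ) : ℂ) + z * conj p - conj z * p) : ℂ) =
    ((-A : ℝ) : ℂ) * (((‖p‖ ^ 2 : ℝ) : ℂ) + (z * conj p - conj z * p)) by push_cast; ring,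
    re_ofReal_mul, add_re, ofReal_re]
  simp

/-- The phase `z conj p - conj z p` is purely imaginary, and `x exp(-x) ≤ 1` trades the Gaussian for
two more powers of `1/|p|`. Exponent three is enough for convergence over a lattice of rank two. -/
theorem norm_kernel_le {A : ℝ} (hA : 0 < A) (z p : ℂ) : ‖kernel A z p‖ ≤ A⁻¹ * (‖p‖ ^ 3)⁻¹ := by
  rw [norm_kernel]
  rcases (norm_nonneg p).eq_or_lt with h | h
  · rw [← h]; simp
  · have h1 : A * ‖p‖ ^ 2 * Real.exp (-A * ‖p‖ ^ 2) ≤ 1 := by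
      have := Real.add_one_le_exp (A * ‖p‖ ^ 2)
      have h2 : Real.exp (-A * ‖p‖ ^ 2) * Real.exp (A * ‖p‖ ^ 2) = 1 := by
        rw [← Real.exp_add]; simp
      nlinarith [Real.exp_pos (-A * ‖p‖ ^ 2)]
    rw [← mul_inv, div_le_iff₀ h, inv_mul_eq_div, le_div_iff₀ (by positivity)]
    calc _ = ‖p‖ * (A * ‖p‖ ^ 2 * Real.exp (-A * ‖p‖ ^ 2)) := by ring
      _ ≤ ‖p‖ * 1 := by gcongr
      _ = ‖p‖ := mul_one _

theorem summable_kernel {τ : ℂ} (hτ : 0 < τ.im) {A : ℝ} (hA : 0 < A) (z x : ℂ) (u : ℤ × ℤ → ℂ)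
    (hu : ∀ p, ‖u p‖ ≤ 1) : Summable fun p : ℤ × ℤ => u p * kernel A z (x + p.1 * τ + p.2) := by
  refine .of_norm_bounded ((summable_norm_add_lattice_inv_pow hτ x).mul_left A⁻¹) fun p => ?_
  rw [norm_mul]
  calc _ ≤ 1 * _ := mul_le_mul_of_nonneg_right (hu p) (norm_nonneg _)
    _ ≤ _ := by rw [one_mul]; exact norm_kernel_le hA _ _

/-- The `SL₂(ℤ)`-invariant sign character of the lattice. -/
noncomputable def latticeSign (c d : ℤ) : ℂ := (-1) ^ (c * d + c + d)

/-- The Gaussian parameter `π (2m+1) / (2 Im τ)`. -/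
noncomputable def gaussParam (m : ℕ) (τ : ℂ) : ℝ := π * (2 * m + 1) / (2 * τ.im)

theorem gaussParam_pos (m : ℕ) {τ : ℂ} (hτ : 0 < τ.im) : 0 < gaussParam m τ := by
  unfold gaussParam; positivity

/-- The lattice series which represents the completed `Φ₁`. -/
noncomputable def latticeSeries (m : ℕ) (τ z₁ z₂ : ℂ) : ℂ :=
  cexp (-gaussParam m τ * z₂ * (z₁ - conj z₁)) *
    ∑' p : ℤ × ℤ, latticeSign p.1 p.2 * kernel (gaussParam m τ) z₂ (z₁ + p.1 * τ + p.2)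

/-- The factor `(-1)^c exp (π i (2m+1) c (z₁ + z₂)) q^{(2m+1) c² / 2}`. -/
noncomputable def rowFactor (m : ℕ) (τ z₁ z₂ : ℂ) (c : ℤ) : ℂ :=
  (-1) ^ c * cexp (π * I * (2 * m + 1) * c * (z₁ + z₂) + π * I * (2 * m + 1) * c ^ 2 * τ)

theorem conj_eq_sub (z : ℂ) : conj z = z - 2 * z.im * I := by
  apply Complex.ext <;> simp; ring

/-- Within a row `Im p` is constant, so `conj p = p - 2i Im p` makes the exponent a holomorphic
quadratic in `p`. -/
theorem kernel_row (m : ℕ) {τ : ℂ} (hτ : 0 < τ.im) (z₁ z₂ : ℂ) {κ : ℝ}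
    (hκ : κ ^ 2 = 2 * τ.im / (2 * m + 1)) (c d : ℤ) :
    cexp (-gaussParam m τ * z₂ * (z₁ - conj z₁)) *
      (latticeSign c d * kernel (gaussParam m τ) z₂ (z₁ + c * τ + d)) =
    rowFactor m τ z₁ z₂ c * ((-1) ^ d *
      (gaussTerm κ ((2 * m + 1) * ((z₁ - z₂) / 2).im / τ.im) (z₁ + c * τ + d)
        / (z₁ + c * τ + d))) := by
  have hy : (τ.im : ℂ) ≠ 0 := by exact_mod_cast hτ.ne'
  have hm : (2 * m + 1 : ℂ) ≠ 0 := by exact_mod_cast (by omega : 2 * m + 1 ≠ 0)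
  have hκ' : (κ : ℂ) ^ 2 = 2 * τ.im / (2 * m + 1) := by
    rw [← ofReal_pow, hκ]; push_cast; ring
  rw [kernel, rowFactor, latticeSign, gaussTerm, hκ', neg_one_zpow_eq_exp, neg_one_zpow_eq_exp,
    neg_one_zpow_eq_exp]
  simp only [← mul_div_assoc, ← Complex.exp_add]
  congr 1
  -- The term `cd` of `latticeSign` and the cross term `(2m+1)cd` of the quadratic exponent combine
  -- to an even multiple of `πi`; this is why the sign contains `cd`.
  refine Complex.exp_eq_exp_iff_exists_int.2 ⟨(m + 1) * c * d, ?_⟩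
  have e1 : conj (z₁ + c * τ + d) = z₁ + c * τ + d - 2 * (z₁.im + c * τ.im) * I := by
    simp only [map_add, map_mul, conj_eq_sub]
    simp
    ring
  have e2 : ((((z₁ - z₂) / 2).im : ℝ) : ℂ) = (z₁.im - z₂.im) / 2 := by
    have : ((z₁ - z₂) / 2).im = (z₁.im - z₂.im) / 2 := by simp
    rw [this]; push_cast; rfl
  rw [e1, conj_eq_sub z₁, conj_eq_sub z₂, gaussParam]
  push_cast
  rw [e2]
  field_simp
  ring_nf

theorem hasSum_row (m : ℕ) {τ : ℂ} (hτ : 0 < τ.im) (z₁ z₂ : ℂ) {κ : ℝ} (hκ0 : 0 < κ)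
    (hκ : κ ^ 2 = 2 * τ.im / (2 * m + 1)) (c : ℤ) (hz : ∀ d : ℤ, z₁ + c * τ + d ≠ 0) :
    I / (2 * π) * ∑' d : ℤ, cexp (-gaussParam m τ * z₂ * (z₁ - conj z₁)) *
      (latticeSign c d * kernel (gaussParam m τ) z₂ (z₁ + c * τ + d)) =
    rowFactor m τ z₁ z₂ c * (cexp (π * I * (z₁ + c * τ)) / (1 - cexp (2 * π * I * (z₁ + c * τ)))) +
     1 / 2 * ∑' k : ℤ, rowFactor m τ z₁ z₂ c *
      errTerm κ ((2 * m + 1) * ((z₁ - z₂) / 2).im / τ.im) (z₁ + c * τ) k := by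
  simp_rw [kernel_row m hτ z₁ z₂ hκ]
  rw [tsum_mul_left, tsum_mul_left, mul_left_comm, tsum_gaussTerm_div hκ0 _ hz]
  ring

/-! ### The correction term as a double series of error functions. -/

/-- The summand of `zwegersR`. -/
noncomputable def zwegersTerm (m : ℕ) (j : ℤ) (τ v : ℂ) (l : ℤ) : ℂ :=
  let n : ℝ := j + 1 / 2 + (2 * m + 1) * l
  (-1 : ℂ) ^ ((2 * (m : ℤ) + 1) * l)
    * ((Real.sign n
        - errE ((n + (2 * m + 1) * (v.im / τ.im)) * Real.sqrt (τ.im / (m + 1 / 2))) : ℝ) : ℂ)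
    * cexp (-(π * I * n ^ 2 * τ / (2 * m + 1)) - 2 * π * I * n * v)

/-- The summand of `thetaMinus`. -/
noncomputable def thetaTerm (j d : ℝ) (τ z : ℂ) (n : ℤ) : ℂ :=
  (-1 : ℂ) ^ n * cexp (2 * π * I * d * z * (n + j / (2 * d))) * qPow τ (d * (n + j / (2 * d)) ^ 2)

/-- The common scale `√(Im τ / (m + 1/2))` of the error functions. -/
noncomputable def errScale (m : ℕ) (τ : ℂ) : ℝ := Real.sqrt (τ.im / (m + 1 / 2))

theorem errScale_pos (m : ℕ) {τ : ℂ} (hτ : 0 < τ.im) : 0 < errScale m τ := by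
  unfold errScale; positivity

theorem errScale_sq (m : ℕ) {τ : ℂ} (hτ : 0 < τ.im) :
    errScale m τ ^ 2 = 2 * τ.im / (2 * m + 1) := by
  rw [errScale, Real.sq_sqrt (by positivity)]
  field_simp

theorem summable_norm_thetaTerm (j : ℝ) {d : ℝ} (hd : 0 < d) {τ : ℂ} (hτ : 0 < τ.im) (z : ℂ) :
    Summable fun n => ‖thetaTerm j d τ z n‖ := by
  have h := summable_exp_quadratic (a := 2 * π * τ.im * d) (by positivity)
    (-2 * π * d * z.im - 2 * π * τ.im * j) (-π * z.im * j - π * τ.im * j ^ 2 / (2 * d))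
  refine h.congr fun n => ?_
  rw [thetaTerm, qPow, norm_mul, norm_mul, norm_neg_one_zpow, one_mul, Complex.norm_exp,
    Complex.norm_exp, ← Real.exp_add]
  congr 1
  rw [show 2 * π * I * d * z * (n + j / (2 * d)) =
    ((2 * π * d * (n + j / (2 * d)) : ℝ) : ℂ) * z * I by push_cast; ring,
    show 2 * π * I * τ * (d * (n + j / (2 * d)) ^ 2) =
    ((2 * π * d * (n + j / (2 * d)) ^ 2 : ℝ) : ℂ) * τ * I by push_cast; ring,
    mul_I_re, mul_I_re, im_ofReal_mul, im_ofReal_mul]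
  field_simp
  ring

theorem summable_norm_zwegersTerm (m : ℕ) (j : ℤ) {τ : ℂ} (hτ : 0 < τ.im) (v : ℂ) :
    Summable fun l => ‖zwegersTerm m j τ v l‖ := by
  set β : ℝ := (2 * m + 1) * (v.im / τ.im) with hβ
  have hκ := errScale_pos m hτ
  have hm : (0 : ℝ) < 2 * m + 1 := by positivity
  have hm' : (2 * m + 1 : ℂ) ≠ 0 := by exact_mod_cast (by omega : 2 * m + 1 ≠ 0)
  have h := (summable_exp_quadratic (a := π * τ.im * (2 * m + 1)) (by positivity)
    (-2 * π * τ.im * (j + 1 / 2) + (2 * π * v.im - 4 * π * τ.im * β / (2 * m + 1)) * (2 * m + 1))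
    (-(π * τ.im / (2 * m + 1)) * (j + 1 / 2) ^ 2 +
      (2 * π * v.im - 4 * π * τ.im * β / (2 * m + 1)) * (j + 1 / 2)
      - 2 * π * τ.im * β ^ 2 / (2 * m + 1))).mul_left
    (2 * Real.exp (π * errScale m τ ^ 2 * (-β) ^ 2))
  refine .of_nonneg_of_le (fun l => norm_nonneg _) (fun l => ?_) h
  have hn : (j + 1 / 2 + (2 * m + 1) * l : ℝ) ≠ 0 := by
    have := int_add_half_ne_zero (j + (2 * m + 1) * l)
    push_cast at this
    intro h0; apply this; linarith
  have e := abs_errE_sub_sign_le hκ (-β) hn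
  rw [abs_sub_comm, sub_neg_eq_add] at e
  simp only [zwegersTerm]
  rw [norm_mul, norm_mul, norm_neg_one_zpow, one_mul, norm_real, Real.norm_eq_abs, Complex.norm_exp]
  refine (mul_le_mul_of_nonneg_right e (Real.exp_pos _).le).trans_eq ?_
  rw [mul_assoc, ← Real.exp_add]
  congr 2
  set n : ℝ := j + 1 / 2 + (2 * m + 1) * l with hndef
  rw [show -(π * I * (n : ℂ) ^ 2 * τ / (2 * m + 1)) - 2 * π * I * n * v =
    ((-(π * n ^ 2 / (2 * m + 1)) : ℝ) : ℂ) * τ * I + ((-2 * π * n : ℝ) : ℂ) * v * I by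
      push_cast; ring, add_re, mul_I_re, mul_I_re, im_ofReal_mul, im_ofReal_mul, errScale_sq m hτ,
      hndef]
  field_simp
  ring

/-- The general term of the double series which both the correction term and the lattice series
expand into. -/
noncomputable def doubleTerm (m : ℕ) (τ z₁ z₂ : ℂ) (p : ℤ × ℤ) : ℂ :=
  rowFactor m τ z₁ z₂ p.1 * errTerm (errScale m τ) ((2 * m + 1) * ((z₁ - z₂) / 2).im / τ.im)
    (z₁ + p.1 * τ) p.2

theorem exp_regroup (s : ℂ) {x₁ x₂ x₃ x₄ x₅ y₁ y₂ y₃ : ℂ}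
    (h : ∃ n : ℤ, x₁ + x₂ + (x₃ + x₄ + x₅) = y₁ + y₂ + y₃ + n * (2 * π * I)) :
    cexp x₁ * s * cexp x₂ * (cexp x₃ * cexp x₄ * cexp x₅) =
      cexp y₁ * cexp y₂ * (s * cexp y₃) := by
  calc _ = s * cexp (x₁ + x₂ + (x₃ + x₄ + x₅)) := by simp only [Complex.exp_add]; ring
    _ = s * cexp (y₁ + y₂ + y₃) := by rw [Complex.exp_eq_exp_iff_exists_int.2 h]
    _ = _ := by simp only [Complex.exp_add]; ring

/-- The half-integer `n` of `zwegersR` becomes `-(k + 1/2)`, and the row is `c = N + l`. Since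
`errE` and the sign are both odd, no sign is lost. -/
theorem zwegersTerm_mul_thetaTerm (m : ℕ) (j : ℤ) (τ z₁ z₂ : ℂ) (l N : ℤ) :
    zwegersTerm m j τ ((z₁ - z₂) / 2) l * thetaTerm (-(j + 1 / 2)) (m + 1 / 2) τ (z₁ + z₂) N =
      doubleTerm m τ z₁ z₂ (N + l, -(j + (2 * m + 1) * l) - 1) := by
  have hm' : (2 * m + 1 : ℂ) ≠ 0 := by exact_mod_cast (by omega : 2 * m + 1 ≠ 0)
  have hm2 : (m + 1 / 2 : ℂ) ≠ 0 := by
    intro h; apply hm'; linear_combination 2 * h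
  simp only [zwegersTerm, thetaTerm, doubleTerm, rowFactor, errTerm, qPow]
  set β : ℝ := (2 * m + 1) * ((z₁ - z₂) / 2).im / τ.im with hβ
  have e1 : ((-(j + (2 * m + 1) * l) - 1 : ℤ) + 1 / 2 : ℝ) = -(j + 1 / 2 + (2 * m + 1) * l) := by
    push_cast; ring
  have e2 : Real.sign (-(j + 1 / 2 + (2 * m + 1) * l : ℝ)) =
      -Real.sign (j + 1 / 2 + (2 * m + 1) * l) := by
    rw [Real.sign_neg]
  rw [e1, e2, show (-(j + 1 / 2 + (2 * m + 1) * l : ℝ) - β) * errScale m τ =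
    -(((j + 1 / 2 + (2 * m + 1) * l : ℝ) + (2 * m + 1) * (((z₁ - z₂) / 2).im / τ.im)) *
      Real.sqrt (τ.im / (m + 1 / 2))) by rw [hβ, errScale]; ring, errE_neg]
  set S := Real.sign (j + 1 / 2 + (2 * m + 1) * l)
  set E := errE (((j + 1 / 2 + (2 * m + 1) * l : ℝ) + (2 * m + 1) * (((z₁ - z₂) / 2).im / τ.im)) *
      Real.sqrt (τ.im / (m + 1 / 2)))
  rw [show -E - -S = S - E by ring]
  rw [neg_one_zpow_eq_exp, neg_one_zpow_eq_exp, neg_one_zpow_eq_exp]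
  refine exp_regroup _ ⟨m * l, ?_⟩
  push_cast
  field_simp
  ring

/-- The change of summation indices from `(j, l, N)` to `(c, k)`. -/
def doubleIndexEquiv (m : ℕ) : Fin (2 * m + 1) × (ℤ × ℤ) ≃ ℤ × ℤ where
  toFun x := (x.2.2 + x.2.1, -((x.1 : ℤ) + (2 * m + 1) * x.2.1) - 1)
  invFun p := ((Int.divModEquiv (2 * m + 1) (-p.2 - 1)).2,
    ((Int.divModEquiv (2 * m + 1) (-p.2 - 1)).1, p.1 - (Int.divModEquiv (2 * m + 1) (-p.2 - 1)).1))
  left_inv := by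
    rintro ⟨j, l, N⟩
    have h : -(-((j : ℤ) + (2 * m + 1) * l) - 1) - 1 = (Int.divModEquiv (2 * m + 1)).symm (l, j) := by
      rw [Int.divModEquiv_symm_apply]; push_cast; ring
    simp only [h, Equiv.apply_symm_apply]
    simp
  right_inv := by
    rintro ⟨c, k⟩
    have h := (Int.divModEquiv (2 * m + 1)).symm_apply_apply (-k - 1)
    rw [Int.divModEquiv_symm_apply] at h
    push_cast at h
    simp only [Prod.mk.injEq]
    constructor
    · ring
    · linarith

/-- Euclidean division by `2m + 1` merges the residue `j` and the quotient `l` into the single index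
`k`, so the finite sum of products unfolds to a sum over all `(c, k)`. -/
theorem hasSum_doubleTerm (m : ℕ) {τ : ℂ} (hτ : 0 < τ.im) (z₁ z₂ : ℂ) :
    HasSum (doubleTerm m τ z₁ z₂) (∑ j ∈ Finset.range (2 * m + 1),
      zwegersR m j τ ((z₁ - z₂) / 2) * thetaMinus (-(j + 1 / 2)) (m + 1 / 2) τ (z₁ + z₂)) := by
  rw [← (doubleIndexEquiv m).hasSum_iff, ← Fin.sum_univ_eq_sum_range (fun j =>
    zwegersR m j τ ((z₁ - z₂) / 2) * thetaMinus (-(j + 1 / 2)) (m + 1 / 2) τ (z₁ + z₂))]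
  have hs : ∀ j : Fin (2 * m + 1), HasSum (fun q : ℤ × ℤ =>
      zwegersTerm m (j : ℕ) τ ((z₁ - z₂) / 2) q.1 *
        thetaTerm (-((j : ℕ) + 1 / 2)) (m + 1 / 2) τ (z₁ + z₂) q.2)
      (zwegersR m (j : ℕ) τ ((z₁ - z₂) / 2) *
        thetaMinus (-((j : ℕ) + 1 / 2)) (m + 1 / 2) τ (z₁ + z₂)) := by
    intro j
    have h1 := summable_norm_zwegersTerm m (j : ℕ) hτ ((z₁ - z₂) / 2)
    have h2 := summable_norm_thetaTerm (-((j : ℕ) + 1 / 2)) (d := m + 1 / 2) (by positivity) hτ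
      (z₁ + z₂)
    exact h1.of_norm.hasSum.mul h2.of_norm.hasSum (summable_mul_of_summable_norm h1 h2)
  have hs' : ∀ j : Fin (2 * m + 1), Summable fun q : ℤ × ℤ =>
      ‖zwegersTerm m (j : ℕ) τ ((z₁ - z₂) / 2) q.1 *
        thetaTerm (-((j : ℕ) + 1 / 2)) (m + 1 / 2) τ (z₁ + z₂) q.2‖ := fun j => (hs j).summable.norm
  have hsum : Summable fun x : Fin (2 * m + 1) × (ℤ × ℤ) =>
      zwegersTerm m (x.1 : ℕ) τ ((z₁ - z₂) / 2) x.2.1 *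
        thetaTerm (-((x.1 : ℕ) + 1 / 2)) (m + 1 / 2) τ (z₁ + z₂) x.2.2 := by
    refine Summable.of_norm ((summable_prod_of_nonneg fun _ => norm_nonneg _).2 ⟨hs', ?_⟩)
    exact (hasSum_fintype _).summable
  have h := hsum.hasSum
  have h2 := (h.prod_fiberwise hs).unique (hasSum_fintype _)
  rw [h2] at h
  exact h.congr_fun fun x => by
    have := zwegersTerm_mul_thetaTerm m (x.1 : ℕ) τ z₁ z₂ x.2.1 x.2.2
    push_cast at this
    exact this.symm

/-- The substitution `l ↦ -1 - l` sends `n` to `-n`. The sign from the odd modulus `2m + 1` cancels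
the one from the odd functions. -/
theorem zwegersR_reflect (m : ℕ) (j : ℤ) (τ v : ℂ) :
    zwegersR m (2 * m - j) τ v = zwegersR m j τ (-v) := by
  change ∑' l, zwegersTerm m (2 * m - j) τ v l = ∑' l, zwegersTerm m j τ (-v) l
  rw [← (Equiv.subLeft (-1 : ℤ)).tsum_eq]
  refine tsum_congr fun l => ?_
  simp only [Equiv.subLeft_apply, zwegersTerm]
  set n : ℝ := j + 1 / 2 + (2 * m + 1) * l with hn
  have e1 : (((2 * m - j : ℤ) : ℝ) + 1 / 2 + (2 * m + 1) * ((-1 - l : ℤ) : ℝ)) = -n := by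
    rw [hn]; push_cast; ring
  rw [e1, Real.sign_neg, neg_im, show (-n + (2 * m + 1) * (v.im / τ.im)) * √(τ.im / (m + 1 / 2)) =
    -((n + (2 * m + 1) * (-v.im / τ.im)) * √(τ.im / (m + 1 / 2))) by ring, errE_neg]
  have e2 : (-1 : ℂ) ^ ((2 * (m : ℤ) + 1) * (-1 - l)) = -(-1 : ℂ) ^ ((2 * (m : ℤ) + 1) * l) := by
    rw [neg_one_zpow_eq_exp, neg_one_zpow_eq_exp, neg_exp_eq]
    refine Complex.exp_eq_exp_iff_exists_int.2 ⟨-(m + 1 + (2 * m + 1) * l), ?_⟩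
    push_cast
    ring
  rw [e2]
  push_cast
  ring_nf

theorem thetaMinus_reflect (j : ℝ) {d : ℝ} (hd : d ≠ 0) (τ z : ℂ) :
    thetaMinus (2 * d - j) d τ z = -thetaMinus (-j) d τ z := by
  change ∑' n, thetaTerm (2 * d - j) d τ z n = -∑' n, thetaTerm (-j) d τ z n
  rw [← (Equiv.subRight (1 : ℤ)).tsum_eq, ← tsum_neg]
  refine tsum_congr fun n => ?_
  have hd' : (d : ℂ) ≠ 0 := by exact_mod_cast hd
  have e : ((n - 1 : ℤ) : ℂ) + ((2 * d - j : ℝ) : ℂ) / (2 * d) = n + ((-j : ℝ) : ℂ) / (2 * d) := by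
    push_cast; field_simp; ring
  rw [Equiv.subRight_apply, thetaTerm, thetaTerm, e, zpow_sub₀ (by norm_num)]
  ring

/-- Reversing `j ↦ 2m - j` shows that `phiAdd` is antisymmetric in the same way as `phi`: its two
theta parts complete the two halves `phiOne m τ z₁ z₂ t` and `phiOne m τ z₂ z₁ t` separately. -/
theorem sum_zwegersR_mul_thetaMinus_pos (m : ℕ) (τ z₁ z₂ : ℂ) :
    ∑ j ∈ Finset.range (2 * m + 1),
      zwegersR m j τ ((z₁ - z₂) / 2) * thetaMinus (j + 1 / 2) (m + 1 / 2) τ (z₁ + z₂) =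
    -∑ j ∈ Finset.range (2 * m + 1),
      zwegersR m j τ ((z₂ - z₁) / 2) * thetaMinus (-(j + 1 / 2)) (m + 1 / 2) τ (z₂ + z₁) := by
  rw [← Finset.sum_range_reflect, ← Finset.sum_neg_distrib]
  refine Finset.sum_congr rfl fun j hj => ?_
  have hj' : j ≤ 2 * m := by have := Finset.mem_range.1 hj; omega
  rw [show 2 * m + 1 - 1 - j = 2 * m - j by omega, Nat.cast_sub hj', Nat.cast_sub hj']
  push_cast
  rw [zwegersR_reflect, show (2 * m - j + 1 / 2 : ℝ) = 2 * (m + 1 / 2) - (j + 1 / 2) by ring,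
    thetaMinus_reflect _ (by positivity), show -((z₁ - z₂) / 2) = (z₂ - z₁) / 2 by ring,
    add_comm z₁ z₂]
  ring

/-- The summand of `phiOne`. -/
noncomputable def phiOneTerm (m : ℕ) (τ z₁ z₂ : ℂ) (j : ℤ) : ℂ :=
  (-1 : ℂ) ^ j *
      (cexp (π * I * j * (2 * m + 1) * (z₁ + z₂) + π * I * z₁)
        * qPow τ ((m + 1 / 2) * j ^ 2 + j / 2)
        / (1 - cexp (2 * π * I * z₁) * qPow τ j))

theorem phiOneTerm_eq (m : ℕ) (τ z₁ z₂ : ℂ) (c : ℤ) :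
    phiOneTerm m τ z₁ z₂ c = rowFactor m τ z₁ z₂ c *
      (cexp (π * I * (z₁ + c * τ)) / (1 - cexp (2 * π * I * (z₁ + c * τ)))) := by
  have e1 : cexp (π * I * c * (2 * m + 1) * (z₁ + z₂) + π * I * z₁) *
      qPow τ ((m + 1 / 2) * c ^ 2 + c / 2) =
      cexp (π * I * (2 * m + 1) * c * (z₁ + z₂) + π * I * (2 * m + 1) * c ^ 2 * τ) *
        cexp (π * I * (z₁ + c * τ)) := by
    rw [qPow, ← Complex.exp_add, ← Complex.exp_add]
    ring_nf
  have e2 : cexp (2 * π * I * z₁) * qPow τ c = cexp (2 * π * I * (z₁ + c * τ)) := by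
    rw [qPow, ← Complex.exp_add]
    ring_nf
  rw [phiOneTerm, rowFactor, e1, e2]
  ring

theorem tsum_phiOneTerm_add (m : ℕ) {τ : ℂ} (hτ : 0 < τ.im) (z₁ z₂ : ℂ)
    (hz : ∀ c d : ℤ, z₁ + c * τ + d ≠ 0) :
    ∑' c, phiOneTerm m τ z₁ z₂ c + 1 / 2 * ∑ j ∈ Finset.range (2 * m + 1),
      zwegersR m j τ ((z₁ - z₂) / 2) * thetaMinus (-(j + 1 / 2)) (m + 1 / 2) τ (z₁ + z₂) =
    I / (2 * π) * latticeSeries m τ z₁ z₂ := by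
  have hD := hasSum_doubleTerm m hτ z₁ z₂
  have hP := (summable_kernel hτ (gaussParam_pos m hτ) z₂ z₁ (fun p => latticeSign p.1 p.2)
    (fun p => by simp [latticeSign])).mul_left (cexp (-gaussParam m τ * z₂ * (z₁ - conj z₁)))
  have hrow : ∀ c : ℤ, phiOneTerm m τ z₁ z₂ c + 1 / 2 * ∑' k, doubleTerm m τ z₁ z₂ (c, k) =
      I / (2 * π) * ∑' d : ℤ, cexp (-gaussParam m τ * z₂ * (z₁ - conj z₁)) *
      (latticeSign c d * kernel (gaussParam m τ) z₂ (z₁ + c * τ + d)) := by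
    intro c
    rw [hasSum_row m hτ z₁ z₂ (errScale_pos m hτ) (errScale_sq m hτ) c (hz c), phiOneTerm_eq]
    rfl
  have h1 := hP.prod.mul_left (I / (2 * π))
  have h2 := hD.summable.prod.mul_left (1 / 2)
  -- The Appell series needs no estimate of its own: it is a difference of two row-sum series
  -- already known to converge.
  have h3 : Summable (phiOneTerm m τ z₁ z₂) :=
    (h1.sub h2).congr fun c => by rw [← hrow c]; ring
  rw [latticeSeries, ← hD.tsum_eq, hD.summable.tsum_prod, ← tsum_mul_left, ← h3.tsum_add h2,
    ← tsum_mul_left, hP.tsum_prod, ← tsum_mul_left]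
  exact tsum_congr hrow

/-- The completed function `phiMod` as a difference of two lattice series. -/
theorem phiMod_eq_latticeSeries (m : ℕ) {τ : ℂ} (hτ : 0 < τ.im) (z₁ z₂ t : ℂ)
    (hz₁ : ∀ c d : ℤ, z₁ + c * τ + d ≠ 0) (hz₂ : ∀ c d : ℤ, z₂ + c * τ + d ≠ 0) :
    phiMod m τ z₁ z₂ t = cexp (2 * π * I * (m + 1 / 2) * t) * (I / (2 * π)) *
      (latticeSeries m τ z₁ z₂ - latticeSeries m τ z₂ z₁) := by
  rw [mul_assoc, mul_sub, ← tsum_phiOneTerm_add m hτ z₁ z₂ hz₁, ← tsum_phiOneTerm_add m hτ z₂ z₁ hz₂]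
  have e : ∀ z₁ z₂, phiOne m τ z₁ z₂ t =
      cexp (2 * π * I * (m + 1 / 2) * t) * ∑' c, phiOneTerm m τ z₁ z₂ c := fun _ _ => rfl
  simp only [phiMod, phi, phiAdd, mul_add, Finset.sum_add_distrib,
    sum_zwegersR_mul_thetaMinus_pos, e]
  ring

/-! ### Lattice series for the numerators `psiMod`. -/

/-- The character by which the lattice terms of `psiMod` are weighted. -/
noncomputable def latticeWeight (M m : ℕ) (ε b : ℝ) (p : ℤ × ℤ) : ℂ :=
  latticeSign p.1 p.2 * cexp (π * I * (2 * m + 1) * (-(b * (p.2 + ε)) / M + ε * p.1))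

/-- The lattice series which represents one half of `psiMod`. -/
noncomputable def halfPsi (M m : ℕ) (ε a b : ℝ) (τ z₁ z₂ : ℂ) : ℂ :=
  cexp (-gaussParam m (M * τ) * z₂ * (z₁ - conj z₁)) * ∑' p : ℤ × ℤ,
    latticeWeight M m ε b p * kernel (gaussParam m (M * τ)) z₂ (z₁ + (a + p.1 * M) * τ + (p.2 + ε))

theorem natCast_mul_im (M : ℕ) (τ : ℂ) : (M * τ).im = M * τ.im := by
  rw [← ofReal_natCast, im_ofReal_mul]

/-- The shift by `aτ + ε` moves the lattice, and the elementary prefactor of `psiMod` absorbs the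
change of the non-holomorphic factor. What remains is unimodular and depends on `b` but not on `a`.
-/
theorem mul_latticeSeries_eq_halfPsi (M m : ℕ) (hM : 1 ≤ M) (ε a b : ℝ) {τ : ℂ} (hτ : 0 < τ.im)
    (z₁ z₂ : ℂ) :
    qPow τ ((2 * m + 1) / (2 * M) * a * b)
      * cexp (2 * π * I * (2 * m + 1) / (2 * M) * (b * z₁ + a * z₂))
      * latticeSeries m (M * τ) (z₁ + a * τ + ε) (z₂ + b * τ + ε) = halfPsi M m ε a b τ z₁ z₂ := by
  have hM' : (M : ℂ) ≠ 0 := by exact_mod_cast (by omega : M ≠ 0)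
  have hy : (τ.im : ℂ) ≠ 0 := by exact_mod_cast hτ.ne'
  rw [latticeSeries, halfPsi, qPow, ← tsum_mul_left, ← tsum_mul_left, ← tsum_mul_left]
  refine tsum_congr fun p => ?_
  have ep : z₁ + a * τ + ε + p.1 * (M * τ) + p.2 = z₁ + (a + p.1 * M) * τ + (p.2 + ε) := by ring
  rw [ep, latticeWeight, kernel, kernel]
  have h1 : conj (z₁ + (a + p.1 * M) * τ + (p.2 + ε)) =
      z₁ + (a + p.1 * M) * τ + (p.2 + ε) - 2 * (z₁.im + (a + p.1 * M) * τ.im) * I := by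
    simp only [map_add, map_mul, conj_eq_sub]
    simp
    ring
  have h2 : conj (z₂ + b * τ + ε) = z₂ + b * τ + ε - 2 * (z₂.im + b * τ.im) * I := by
    simp only [map_add, map_mul, conj_eq_sub]
    simp
    ring
  have h3 : conj (z₁ + a * τ + ε) = z₁ + a * τ + ε - 2 * (z₁.im + a * τ.im) * I := by
    simp only [map_add, map_mul, conj_eq_sub]
    simp
    ring
  rw [h1, h2, h3, conj_eq_sub z₁, conj_eq_sub z₂, gaussParam, natCast_mul_im]
  have key : ∀ (s r : ℂ) {x₁ x₂ x₃ x₄ y₁ y₂ y₃ : ℂ}, x₁ + x₂ + x₃ + x₄ = y₁ + y₂ + y₃ →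
      cexp x₁ * cexp x₂ * (cexp x₃ * (s * (cexp x₄ / r))) =
        cexp y₁ * (s * cexp y₂ * (cexp y₃ / r)) := by
    intro s r x₁ x₂ x₃ x₄ y₁ y₂ y₃ h
    calc _ = s * cexp (x₁ + x₂ + x₃ + x₄) / r := by simp only [Complex.exp_add]; ring
      _ = s * cexp (y₁ + y₂ + y₃) / r := by rw [h]
      _ = _ := by simp only [Complex.exp_add]; ring
  apply key
  push_cast
  field_simp
  ring

theorem psiMod_eq_halfPsi (M m : ℕ) (hM : 1 ≤ M) (ε a b : ℝ) {τ : ℂ} (hτ : 0 < τ.im) (z₁ z₂ t : ℂ)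
    (hz₁ : ∀ c d : ℤ, z₁ + (a + c * M) * τ + (d + ε) ≠ 0)
    (hz₂ : ∀ c d : ℤ, z₂ + (b + c * M) * τ + (d + ε) ≠ 0) :
    psiMod M m ε a b τ z₁ z₂ t = cexp (2 * π * I * (m + 1 / 2) * (t / M)) * (I / (2 * π)) *
      (halfPsi M m ε a b τ z₁ z₂ - halfPsi M m ε b a τ z₂ z₁) := by
  have hMτ : 0 < (M * τ).im := by
    rw [natCast_mul_im]
    have : (0 : ℝ) < M := by exact_mod_cast hM
    positivity
  rw [psiMod, phiMod_eq_latticeSeries m hMτ, ← mul_latticeSeries_eq_halfPsi M m hM ε a b hτ,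
    ← mul_latticeSeries_eq_halfPsi M m hM ε b a hτ]
  · rw [add_comm (b * z₁) (a * z₂), show ((2 * m + 1) / (2 * M) * a * b : ℂ) =
      (2 * m + 1) / (2 * M) * b * a by ring]
    ring
  · intro c d
    convert hz₁ c d using 1
    ring
  · intro c d
    convert hz₂ c d using 1
    ring

/-! ### Numerators under `τ ↦ -1/τ`. -/

theorem kernel_div {τ : ℂ} (hτ : τ ≠ 0) (A : ℝ) (z p : ℂ) :
    kernel (A * normSq τ) (z / τ) (p / τ) = τ * kernel A z p := by
  have h : (conj τ : ℂ) ≠ 0 := by simpa using hτ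
  rw [kernel, kernel, ofReal_mul, normSq_eq_conj_mul_self, map_div₀, map_div₀]
  rw [div_div_eq_mul_div, mul_comm (cexp _) τ, mul_div_assoc]
  congr 3
  field_simp

theorem gaussParam_neg_inv (M m : ℕ) (hM : 1 ≤ M) {τ : ℂ} (hτ : 0 < τ.im) :
    gaussParam m (M * (-1 / τ)) = gaussParam m (M * τ) * normSq τ := by
  have h0 : normSq τ ≠ 0 := by
    rw [Ne, normSq_eq_zero]; rintro rfl; simp at hτ
  have hM' : (M : ℝ) ≠ 0 := by exact_mod_cast (by omega : M ≠ 0)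
  have h1 : (-1 / τ).im = τ.im / normSq τ := by
    rw [neg_div, neg_im, one_div, inv_im]; ring
  rw [gaussParam, gaussParam, natCast_mul_im, natCast_mul_im, h1]
  have := hτ.ne'
  field_simp

/-- The shift of `t` by `-z₁z₂/τ` is exactly what restores the non-holomorphic prefactor. -/
theorem halfPsi_prefactor_neg_inv (M m : ℕ) (hM : 1 ≤ M) {τ : ℂ} (hτ : 0 < τ.im) (z₁ z₂ : ℂ) :
    cexp (2 * π * I * (m + 1 / 2) * (-(z₁ * z₂ / τ) / M)) *
      cexp (-gaussParam m (M * (-1 / τ)) * (z₂ / τ) * (z₁ / τ - conj (z₁ / τ))) =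
      cexp (-gaussParam m (M * τ) * z₂ * (z₁ - conj z₁)) := by
  have hτ0 : τ ≠ 0 := by rintro rfl; simp at hτ
  have h : (conj τ : ℂ) ≠ 0 := by simpa using hτ0
  have hM' : (M : ℂ) ≠ 0 := by exact_mod_cast (by omega : M ≠ 0)
  have hy : (τ.im : ℂ) ≠ 0 := by exact_mod_cast hτ.ne'
  rw [gaussParam_neg_inv M m hM hτ, ofReal_mul, normSq_eq_conj_mul_self, map_div₀, ← Complex.exp_add,
    gaussParam, natCast_mul_im]
  congr 1
  push_cast
  field_simp
  rw [conj_eq_sub τ]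
  ring

/-- Summation over residues modulo `M` combined with summation over the multiples of `M`. -/
def residueIndexEquiv (M : ℕ) [NeZero M] : Fin M × (ℤ × ℤ) ≃ ℤ × ℤ where
  toFun x := ((x.1 : ℤ) + x.2.1 * M, x.2.2)
  invFun p := ((Int.divModEquiv M p.1).2, ((Int.divModEquiv M p.1).1, p.2))
  left_inv := by
    rintro ⟨j, l, N⟩
    have h : (j : ℤ) + l * M = (Int.divModEquiv M).symm (l, j) := by
      rw [Int.divModEquiv_symm_apply]; ring
    simp only [h, Equiv.apply_symm_apply]
  right_inv := by
    rintro ⟨a, d⟩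
    have h := (Int.divModEquiv M).symm_apply_apply a
    rw [Int.divModEquiv_symm_apply] at h
    simp only [Prod.mk.injEq, and_true]
    linarith

/-- The inner sum depends on `p` only through its residues. The first residue and `q.1` together run
once over all integers; the second residue remains as an independent variable `y`, ready for a
finite Fourier sum. -/
theorem sum_tsum_residues (M : ℕ) [NeZero M] (Ω : Finset (ℤ × ℤ))
    (hΩ : Set.BijOn (fun p : ℤ × ℤ => ((p.1 : ZMod M), (p.2 : ZMod M))) Ω Set.univ)
    (F : ℤ → ZMod M → ℤ → ℂ) (hF : ∀ y, Summable fun q : ℤ × ℤ => F q.1 y q.2) :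
    ∑ p ∈ Ω, ∑' q : ℤ × ℤ, F (p.1 + q.1 * M) p.2 q.2 =
      ∑' q : ℤ × ℤ, ∑ y : ZMod M, F q.1 y q.2 := by
  have hM : (M : ℤ) ≠ 0 := by exact_mod_cast NeZero.ne M
  let T : ZMod M → ZMod M → ℂ := fun x y => ∑' q : ℤ × ℤ, F ((x.val : ℤ) + q.1 * M) y q.2
  have h1 : ∀ p : ℤ × ℤ, ∑' q : ℤ × ℤ, F (p.1 + q.1 * M) p.2 q.2 = T p.1 p.2 := by
    intro p
    have h : ((p.1 : ZMod M).val : ℤ) = p.1 % M := ZMod.val_intCast p.1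
    simp only [T, h]
    conv_rhs => rw [← ((Equiv.addRight (p.1 / (M : ℤ))).prodCongr (Equiv.refl ℤ)).tsum_eq]
    refine tsum_congr fun q => ?_
    simp only [Equiv.prodCongr_apply, Equiv.coe_addRight, Equiv.coe_refl, Prod.map_fst, Prod.map_snd,
      id]
    congr 1
    linarith [Int.emod_add_ediv_mul p.1 M, add_mul q.1 (p.1 / M) M]
  have h2 : ∑ p ∈ Ω, T p.1 p.2 = ∑ x : ZMod M × ZMod M, T x.1 x.2 :=
    Finset.sum_nbij (fun p : ℤ × ℤ => ((p.1 : ZMod M), (p.2 : ZMod M))) (fun _ _ => Finset.mem_univ _)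
      hΩ.injOn (by simpa using hΩ.surjOn) (fun _ _ => rfl)
  have h3 : ∀ y, ∑ x : ZMod M, T x y = ∑' q : ℤ × ℤ, F q.1 y q.2 := by
    intro y
    have hs := (residueIndexEquiv M).summable_iff.2 (hF y)
    have h4 : ∑' c : Fin M × ℤ × ℤ, F (residueIndexEquiv M c).1 y (residueIndexEquiv M c).2 =
        ∑' x : Fin M, ∑' q : ℤ × ℤ, F ((x : ℤ) + q.1 * M) y q.2 := Summable.tsum_prod hs
    rw [← (residueIndexEquiv M).tsum_eq, h4, tsum_fintype]
    refine Finset.sum_equiv (ZMod.finEquiv M).symm.toEquiv (by simp) fun x _ => ?_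
    have : (((ZMod.finEquiv M).symm x : Fin M) : ℤ) = (x.val : ℤ) := by
      obtain ⟨n, hn⟩ := Nat.exists_eq_succ_of_ne_zero (NeZero.ne M)
      subst hn
      rfl
    simp only [T]
    erw [this]
  rw [Finset.sum_congr rfl fun p _ => h1 p, h2, Fintype.sum_prod_type_right]
  simp only
  rw [Finset.sum_congr rfl fun y _ => h3 y, Summable.tsum_finsetSum fun y _ => hF y]

theorem sum_stdAddChar_mul (M : ℕ) [NeZero M] (x : ZMod M) [Decidable (x = 0)] :
    ∑ y : ZMod M, ZMod.stdAddChar (y * x) = if x = 0 then (M : ℂ) else 0 := by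
  simpa using AddChar.sum_mulShift x (ZMod.isPrimitive_stdAddChar M)

/-- The weight of the lattice term `(α, d)` in the sum over all numerators. -/
noncomputable def fourierWeight (M m : ℕ) [NeZero M] (r e e' j k : ℤ) (α : ℤ)
    (y : ZMod M) (d : ℤ) : ℂ :=
  (-1) ^ (α + d + α * (d + e' + j)) *
    cexp (-(π * I * (2 * m + 1) / M * ((α + e / 2) * (e' / 2 + k) + e / 2 * (d + e' + j)))) *
    ZMod.stdAddChar (y * (((d + e' + j) * r : ℤ) : ZMod M))

/-- With `x = d + e' + j` and `2m + 1 = M - 2r`, the phase `exp(-πi(2m+1)bx/M)` is `(-1)^(bx)` times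
`exp(2πi rbx/M)`, an honest character of `b` modulo `M`. The sign is rewritten in terms of `α` using
`a ≡ b` modulo `2`. -/
theorem fourierWeight_eq (M m : ℕ) [NeZero M] {r e e' j k a b : ℤ} (hr : (M : ℤ) = 2 * r + (2 * m + 1))
    (hab : 2 ∣ a - b) (hjk : 2 ∣ j - k) (q : ℤ × ℤ) :
    (-1) ^ a * cexp (-(π * I * (2 * m + 1) / M *
      ((e / 2 + b) * (e' / 2 + j) + (e / 2 + a) * (e' / 2 + k)))) *
      latticeWeight M m (e' / 2) (e / 2 + b) q =
    fourierWeight M m r e e' j k (a + q.1 * M) b q.2 := by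
  obtain ⟨u, hu⟩ := hab
  obtain ⟨v, hv⟩ := hjk
  obtain rfl : a = b + 2 * u := by linarith
  obtain rfl : j = k + 2 * v := by linarith
  obtain ⟨c, d⟩ := q
  have hM' : (M : ℂ) ≠ 0 := by exact_mod_cast NeZero.ne M
  have hr' : (M : ℂ) = 2 * r + (2 * m + 1) := by exact_mod_cast hr
  have h1 : (b : ZMod M) * (((d + e' + (k + 2 * v)) * r : ℤ) : ZMod M) =
      ((b * ((d + e' + (k + 2 * v)) * r) : ℤ) : ZMod M) := by push_cast; ring
  rw [fourierWeight, latticeWeight, latticeSign, h1, ZMod.stdAddChar_coe, neg_one_zpow_eq_exp,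
    neg_one_zpow_eq_exp, neg_one_zpow_eq_exp]
  simp only [← Complex.exp_add]
  refine Complex.exp_eq_exp_iff_exists_int.2 ⟨c * (-m * d - m - r - (2 * m + 1) * v
    - r * (d + e' + (k + 2 * v))) - (b + u) * (d + e' + (k + 2 * v)), ?_⟩
  push_cast
  field_simp
  rw [hr']
  ring

theorem sum_fourierWeight (M m : ℕ) [NeZero M] {r : ℤ} (hr : (M : ℤ) = 2 * r + (2 * m + 1))
    (hgcd : Nat.gcd M (4 * m + 2) = 1) (e e' j k α d : ℤ) :
    ∑ y : ZMod M, fourierWeight M m r e e' j k α y d =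
      if (M : ℤ) ∣ d + e' + j then M * ((-1) ^ (α + d + α * (d + e' + j)) *
        cexp (-(π * I * (2 * m + 1) / M * ((α + e / 2) * (e' / 2 + k) + e / 2 * (d + e' + j)))))
      else 0 := by
  have hcop : IsCoprime (M : ℤ) r := by
    have h1 : IsCoprime (M : ℤ) (4 * m + 2 : ℕ) := Nat.isCoprime_iff_coprime.2 hgcd
    obtain ⟨x, y, h⟩ := h1
    -- A Bézout relation for `M` and `r`, obtained from `4m + 2 = 2M - 4r`.
    refine ⟨x + 2 * y, -4 * y, ?_⟩
    push_cast at h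
    linear_combination h + 2 * y * hr
  have hiff : (((d + e' + j) * r : ℤ) : ZMod M) = 0 ↔ (M : ℤ) ∣ d + e' + j := by
    rw [ZMod.intCast_zmod_eq_zero_iff_dvd]
    exact ⟨hcop.dvd_of_dvd_mul_right, fun h => h.mul_right _⟩
  simp only [fourierWeight]
  rw [← Finset.mul_sum, sum_stdAddChar_mul, mul_ite, mul_zero, mul_comm (M : ℂ)]
  exact if_congr hiff rfl rfl

theorem norm_fourierWeight (M m : ℕ) [NeZero M] (r e e' j k α : ℤ) (y : ZMod M) (d : ℤ) :
    ‖fourierWeight M m r e e' j k α y d‖ = 1 := by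
  rw [fourierWeight, norm_mul, norm_mul, norm_neg_one_zpow, AddChar.norm_apply, one_mul, mul_one,
    show -(π * I * (2 * m + 1) / M * ((α + e / 2) * (e' / 2 + k) + e / 2 * (d + e' + j))) =
    ((-(π * (2 * m + 1) / M * ((α + e / 2) * (e' / 2 + k) + e / 2 * (d + e' + j))) : ℝ) : ℂ) * I by
      push_cast; ring, norm_exp_ofReal_mul_I]

/-- The lattice terms which survive the summation over all numerators. -/
theorem fourierWeight_survivor (M m : ℕ) [NeZero M] {r : ℤ} (hr : (M : ℤ) = 2 * r + (2 * m + 1))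
    (e e' j k c α : ℤ) :
    (-1 : ℂ) ^ j * latticeWeight M m (e / 2) (e' / 2 + k) (c, α) =
      (-1) ^ e' * ((-1) ^ (α + (-j - e' - c * M) + α * ((-j - e' - c * M) + e' + j)) *
        cexp (-(π * I * (2 * m + 1) / M * ((α + e / 2) * (e' / 2 + k) +
          e / 2 * (((-j - e' - c * M : ℤ) : ℂ) + e' + j))))) := by
  have hM' : (M : ℂ) ≠ 0 := by exact_mod_cast NeZero.ne M
  have hr' : (M : ℂ) = 2 * r + (2 * m + 1) := by exact_mod_cast hr
  rw [latticeWeight, latticeSign, neg_one_zpow_eq_exp, neg_one_zpow_eq_exp, neg_one_zpow_eq_exp,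
    neg_one_zpow_eq_exp]
  simp only [← Complex.exp_add]
  refine Complex.exp_eq_exp_iff_exists_int.2 ⟨j + c * (α + 1) * (r + m + 1), ?_⟩
  push_cast
  field_simp
  rw [hr']
  ring

/-- The right side becomes a sum over all `(α, d)` with a character sum over `y` inside.
Orthogonality leaves `d ≡ -e' - j` modulo `M`, and these points divided by `τ` are the points of the
coset attached to `-1/τ`. -/
theorem halfPsi_neg_inv (M m : ℕ) (hM : 1 ≤ M) (hgcd : Nat.gcd M (4 * m + 2) = 1) (e e' j k : ℤ)
    (hjk : 2 ∣ j - k) (Ω : Finset (ℤ × ℤ))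
    (hΩ : Set.BijOn (fun p : ℤ × ℤ => ((p.1 : ZMod M), (p.2 : ZMod M))) Ω Set.univ)
    (hΩ' : ∀ p ∈ Ω, 2 ∣ p.1 - p.2) {τ : ℂ} (hτ : 0 < τ.im) (z₁ z₂ : ℂ) :
    cexp (2 * π * I * (m + 1 / 2) * (-(z₁ * z₂ / τ) / M)) * ((-1) ^ j *
      halfPsi M m (e / 2) (e' / 2 + j) (e' / 2 + k) (-1 / τ) (z₁ / τ) (z₂ / τ)) =
    (-1) ^ e' * τ / M * ∑ p ∈ Ω, (-1) ^ p.1 * cexp (-(π * I * (2 * m + 1) / M *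
      ((e / 2 + p.2) * (e' / 2 + j) + (e / 2 + p.1) * (e' / 2 + k)))) *
      halfPsi M m (e' / 2) (e / 2 + p.1) (e / 2 + p.2) τ z₁ z₂ := by
  have : NeZero M := ⟨by omega⟩
  have hM' : (M : ℂ) ≠ 0 := by exact_mod_cast NeZero.ne M
  have hτ0 : τ ≠ 0 := by rintro rfl; simp at hτ
  have hMτ : 0 < (M * τ).im := by
    rw [natCast_mul_im]
    have : (0 : ℝ) < M := by exact_mod_cast hM
    positivity
  obtain ⟨r, hr⟩ : ∃ r : ℤ, (M : ℤ) = 2 * r + (2 * m + 1) := by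
    have hodd : ¬ 2 ∣ M := fun h => by
      have : 2 ∣ Nat.gcd M (4 * m + 2) := Nat.dvd_gcd h ⟨2 * m + 1, by ring⟩
      rw [hgcd] at this
      omega
    exact ⟨((M : ℤ) - (2 * m + 1)) / 2, by omega⟩
  set A := gaussParam m (M * τ) with hA
  let K : ℤ → ℤ → ℂ := fun α d => kernel A z₂ (z₁ + (α + e / 2) * τ + (d + e' / 2))
  have hsum : ∀ y : ZMod M, Summable fun q : ℤ × ℤ =>
      fourierWeight M m r e e' j k q.1 y q.2 * K q.1 q.2 := by
    intro y
    refine (summable_kernel hτ (gaussParam_pos m hMτ) z₂ (z₁ + e / 2 * τ + e' / 2)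
      (fun q => fourierWeight M m r e e' j k q.1 y q.2)
      (fun q => (norm_fourierWeight M m r e e' j k q.1 y q.2).le)).congr fun q => ?_
    simp only [K]
    congr 2
    ring
  have hR : ∑ p ∈ Ω, (-1) ^ p.1 * cexp (-(π * I * (2 * m + 1) / M *
      ((e / 2 + p.2) * (e' / 2 + j) + (e / 2 + p.1) * (e' / 2 + k)))) *
      halfPsi M m (e' / 2) (e / 2 + p.1) (e / 2 + p.2) τ z₁ z₂ =
      cexp (-A * z₂ * (z₁ - conj z₁)) * ∑' q : ℤ × ℤ, ∑ y : ZMod M,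
        fourierWeight M m r e e' j k q.1 y q.2 * K q.1 q.2 := by
    rw [← sum_tsum_residues M Ω hΩ (fun α y d => fourierWeight M m r e e' j k α y d * K α d) hsum,
      Finset.mul_sum]
    refine Finset.sum_congr rfl fun p hp => ?_
    rw [halfPsi, mul_left_comm, ← tsum_mul_left]
    congr 1
    refine tsum_congr fun q => ?_
    rw [← fourierWeight_eq M m hr (hΩ' p hp) hjk, mul_assoc]
    simp only [K]
    push_cast
    rw [mul_assoc, show (z₁ + (↑p.1 + ↑q.1 * ↑M + ↑e / 2) * τ + (↑q.2 + ↑e' / 2) : ℂ) =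
      z₁ + (↑e / 2 + ↑p.1 + ↑q.1 * ↑M) * τ + (↑q.2 + ↑e' / 2) by ring]
    simp only [mul_assoc, hA]
  rw [hR, halfPsi, mul_left_comm ((-1 : ℂ) ^ j), ← mul_assoc, halfPsi_prefactor_neg_inv M m hM hτ,
    ← hA, mul_left_comm _ (cexp _)]
  congr 1
  simp_rw [← Finset.sum_mul, sum_fourierWeight M m hr hgcd]
  -- Surviving points are indexed by the lattice index `(c, α)` of the left side: as `-1/τ` swaps
  -- the two directions, `c` now labels the `1`-direction.
  have hinj : Function.Injective fun q : ℤ × ℤ => (q.2, -j - e' - q.1 * (M : ℤ)) := by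
    rintro ⟨c, α⟩ ⟨c', α'⟩ h
    simp only [Prod.mk.injEq] at h
    have hM0 : (M : ℤ) ≠ 0 := by exact_mod_cast NeZero.ne M
    have : c * (M : ℤ) = c' * M := by linarith [h.2]
    rw [mul_right_cancel₀ hM0 this, h.1]
  symm
  rw [← hinj.tsum_eq, ← tsum_mul_left, ← tsum_mul_left]
  · refine tsum_congr fun q => ?_
    symm
    rw [if_pos ⟨-q.1, by ring⟩, ← mul_assoc, gaussParam_neg_inv M m hM hτ, ← hA]
    have ep : z₁ / τ + (((e' / 2 + j : ℝ) : ℂ) + q.1 * M) * (-1 / τ) + (q.2 + ((e / 2 : ℝ) : ℂ)) =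
        (z₁ + (q.2 + e / 2) * τ + (((-j - e' - q.1 * M : ℤ) : ℂ) + e' / 2)) / τ := by
      push_cast
      field_simp
      ring
    rw [ep, kernel_div hτ0, fourierWeight_survivor M m hr e e' j k q.1 q.2]
    simp only [K]
    field_simp
  · intro q hq
    by_contra h
    apply hq
    beta_reduce
    rw [if_neg, zero_mul]
    rintro ⟨c, hc⟩
    exact h ⟨(-c, q.1), by ext <;> simp; linarith⟩

/-! ### Numerators under `τ ↦ τ + 1`. -/

theorem halfPsi_add_one (M m : ℕ) (hM : 1 ≤ M) (e e' e'' s j k : ℤ) (hjk : 2 ∣ j - k)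
    (he : e + e' = e'' + 2 * s) (τ z₁ z₂ : ℂ) :
    halfPsi M m (e / 2) (e' / 2 + j) (e' / 2 + k) (τ + 1) z₁ z₂ =
      (-1) ^ (j + s) * cexp (π * I * (2 * m + 1) / M * ((e' / 2 + j) * (e' / 2 + k))) *
        halfPsi M m (e'' / 2) (e' / 2 + j) (e' / 2 + k) τ z₁ z₂ := by
  have hM' : (M : ℂ) ≠ 0 := by exact_mod_cast (by omega : M ≠ 0)
  have hg : gaussParam m (M * (τ + 1)) = gaussParam m (M * τ) := by
    rw [gaussParam, gaussParam, natCast_mul_im, natCast_mul_im]; simp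
  obtain ⟨v, hv⟩ := hjk
  obtain rfl : j = k + 2 * v := by linarith
  obtain rfl : e = e'' + 2 * s - e' := by linarith
  -- Replacing `τ` by `τ + 1` adds `e'/2 + j + cM` to the constant part of the lattice point; with
  -- `e + e' = e'' + 2s` its integral part is this shear and the rest is the new `e''/2`.
  let σ : ℤ × ℤ ≃ ℤ × ℤ := Equiv.prodShear (Equiv.refl ℤ) fun c => Equiv.addRight (c * M + (k + 2 * v) + s)
  rw [halfPsi, halfPsi, hg, mul_left_comm]
  conv_rhs => rw [← σ.tsum_eq, ← tsum_mul_left]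
  congr 1
  refine tsum_congr fun q => ?_
  obtain ⟨c, d⟩ := q
  have hσ : σ (c, d) = (c, d + (c * M + (k + 2 * v) + s)) := rfl
  rw [hσ, ← mul_assoc]
  congr 1
  · rw [latticeWeight, latticeWeight, latticeSign, latticeSign, neg_one_zpow_eq_exp,
      neg_one_zpow_eq_exp, neg_one_zpow_eq_exp]
    simp only [← Complex.exp_add]
    obtain ⟨u, hu⟩ := Int.even_mul_succ_self c
    refine Complex.exp_eq_exp_iff_exists_int.2
      ⟨-u * M - c * v - (k + 2 * v + s) + m * c * (k + s), ?_⟩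
    have hu' : (c : ℂ) * (c + 1) = u + u := by exact_mod_cast hu
    push_cast
    field_simp
    linear_combination (-4 * M ^ 2 : ℂ) * hu'
  · congr 1
    push_cast
    ring

/-! ### Theta functions, eta and the denominators. -/

theorem jacobiTheta_eq_jacobiTheta₂ (a b : ℝ) (τ z : ℂ) :
    jacobiTheta a b τ z = cexp (π * I * τ * a ^ 2 / 4 + π * I * a * (z + b / 2)) *
      jacobiTheta₂ (z + b / 2 + a * τ / 2) τ := by
  rw [jacobiTheta, jacobiTheta₂, ← tsum_mul_left]
  refine tsum_congr fun n => ?_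
  rw [jacobiTheta₂_term, ← Complex.exp_add]
  congr 1
  ring

theorem jacobiTheta_neg_inv {a b : ℝ} (ha : a = 0 ∨ a = 1) {τ : ℂ} (hτ : 0 < τ.im) (z : ℂ) :
    jacobiTheta a b (-1 / τ) (z / τ) =
      cexp (-(π * I * (a * b) / 2)) * (-I * τ) ^ (1 / 2 : ℂ) * cexp (π * I * z ^ 2 / τ) *
        jacobiTheta b a τ z := by
  have hτ0 : τ ≠ 0 := by rintro rfl; simp at hτ
  have hs : (-I * τ) ^ (1 / 2 : ℂ) ≠ 0 := by
    rw [Complex.cpow_ne_zero_iff_of_exponent_ne_zero (by norm_num)]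
    simp [hτ0]
  have hper : jacobiTheta₂ (z + a / 2 + b * τ / 2) τ = jacobiTheta₂ (z + b * τ / 2 - a / 2) τ := by
    rcases ha with rfl | rfl
    · simp
    · rw [← jacobiTheta₂_add_left (z + b * τ / 2 - (1 : ℝ) / 2)]
      congr 1
      push_cast
      ring
  rw [jacobiTheta_eq_jacobiTheta₂, jacobiTheta_eq_jacobiTheta₂ b a, hper,
    jacobiTheta₂_functional_equation (z + b * τ / 2 - a / 2),
    show (z / τ + b / 2 + a * (-1 / τ) / 2 : ℂ) = (z + b * τ / 2 - a / 2) / τ by field_simp; ring]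
  have key : ∀ (s J : ℂ) {x y₁ y₂ y₃ y₄ : ℂ}, s ≠ 0 → x = y₁ + y₂ + y₃ + y₄ →
      cexp x * J = cexp y₁ * s * cexp y₂ * (cexp y₃ * (1 / s * cexp y₄ * J)) := by
    intro s J x y₁ y₂ y₃ y₄ hs h
    rw [h]
    simp only [Complex.exp_add]
    field_simp
  apply key _ _ hs
  field_simp
  ring

theorem jacobiTheta_one_add_one (b : ℝ) (τ z : ℂ) :
    jacobiTheta 1 b (τ + 1) z = cexp (π * I / 4) * jacobiTheta 1 b τ z := by
  rw [jacobiTheta, jacobiTheta, ← tsum_mul_left]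
  refine tsum_congr fun n => ?_
  rw [← Complex.exp_add]
  obtain ⟨u, hu⟩ := Int.even_mul_succ_self n
  refine Complex.exp_eq_exp_iff_exists_int.2 ⟨u, ?_⟩
  have : (n : ℂ) * (n + 1) = u + u := by exact_mod_cast hu
  push_cast
  linear_combination π * I * this

theorem jacobiTheta_zero_add_one (b b' : ℝ) (k : ℤ) (hb : b' = b + 1 + 2 * k) (τ z : ℂ) :
    jacobiTheta 0 b (τ + 1) z = jacobiTheta 0 b' τ z := by
  rw [jacobiTheta, jacobiTheta]
  refine tsum_congr fun n => ?_
  obtain ⟨u, hu⟩ := Int.even_mul_pred_self n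
  refine Complex.exp_eq_exp_iff_exists_int.2 ⟨u - k * n, ?_⟩
  have : (n : ℂ) * (n - 1) = u + u := by exact_mod_cast hu
  rw [hb]
  push_cast
  linear_combination π * I * this

/-- The reflection `n ↦ -1 - 2N - n` of the summation index negates every term. -/
theorem jacobiTheta₂_eq_zero (τ : ℂ) (N K : ℤ) :
    jacobiTheta₂ (1 / 2 + τ / 2 + N * τ + K) τ = 0 := by
  have h : jacobiTheta₂ (1 / 2 + τ / 2 + N * τ + K) τ =
      -jacobiTheta₂ (1 / 2 + τ / 2 + N * τ + K) τ := by
    conv_lhs => rw [jacobiTheta₂, ← (Equiv.subLeft (-1 - 2 * N)).tsum_eq]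
    rw [jacobiTheta₂, ← tsum_neg]
    refine tsum_congr fun n => ?_
    rw [jacobiTheta₂_term, jacobiTheta₂_term, Equiv.subLeft_apply, neg_exp_eq]
    refine Complex.exp_eq_exp_iff_exists_int.2 ⟨-1 - N - n - K - 2 * N * K - 2 * n * K, ?_⟩
    push_cast
    ring
  have := add_self_eq_zero.1 (eq_neg_iff_add_eq_zero.1 h)
  exact this

theorem jacobiTheta_eq_zero {a b : ℝ} {τ z : ℂ} {N K : ℤ}
    (h : z + b / 2 + a * τ / 2 = 1 / 2 + τ / 2 + N * τ + K) : jacobiTheta a b τ z = 0 := by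
  rw [jacobiTheta_eq_jacobiTheta₂, h, jacobiTheta₂_eq_zero, mul_zero]

/-- Reconciles the branches of the square root in the eta and theta laws: `-Iτ` lies in the right
half-plane, so adding the argument of `I` does not leave the principal range. -/
theorem sqrt_eq_sqrt_I_mul {τ : ℂ} (hτ : 0 < τ.im) :
    (Complex.sqrt I)⁻¹ * Complex.sqrt τ = (-I * τ) ^ (1 / 2 : ℂ) := by
  have hτ0 : τ ≠ 0 := by rintro rfl; simp at hτ
  have h0 : -I * τ ≠ 0 := by simp [hτ0]
  have hlog : Complex.log τ = Complex.log (-I * τ) + Complex.log I := by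
    have hre : 0 < (-I * τ).re := by simpa using hτ
    have harg := Complex.abs_arg_lt_pi_div_two_iff.2 (Or.inl hre)
    rw [abs_lt] at harg
    rw [← Complex.log_mul h0 I_ne_zero]
    · congr 1
      linear_combination τ * I_mul_I
    · rw [arg_I]; constructor <;> linarith [harg.1, harg.2]
  rw [Complex.cpow_def_of_ne_zero h0, _root_.sqrt_eq_exp I_ne_zero, _root_.sqrt_eq_exp hτ0,
    ← Complex.exp_neg, ← Complex.exp_add, hlog]
  congr 1
  ring

theorem eta_neg_inv {τ : ℂ} (hτ : 0 < τ.im) :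
    ModularForm.eta (-1 / τ) = (-I * τ) ^ (1 / 2 : ℂ) * ModularForm.eta τ := by
  have h := ModularForm.eta_comp_eq_csqrt_I_inv (x := τ) hτ
  simp only [Function.comp, Pi.smul_apply, Pi.mul_apply, smul_eq_mul] at h
  rw [h, ← mul_assoc, sqrt_eq_sqrt_I_mul hτ]

theorem eta_add_one_pow_three (τ : ℂ) :
    ModularForm.eta (τ + 1) ^ 3 = cexp (π * I / 4) * ModularForm.eta τ ^ 3 := by
  have h1 : ∀ n, ModularForm.eta_q n (τ + 1) = ModularForm.eta_q n τ := by
    intro n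
    rw [ModularForm.eta_q_eq_pow, ModularForm.eta_q_eq_pow, mul_add, mul_one, Complex.exp_add,
      Complex.exp_two_pi_mul_I, mul_one]
  have h2 : Function.Periodic.qParam 24 (τ + 1) ^ 3 =
      cexp (π * I / 4) * Function.Periodic.qParam 24 τ ^ 3 := by
    rw [Function.Periodic.qParam, Function.Periodic.qParam, ← Complex.exp_nat_mul,
      ← Complex.exp_nat_mul, ← Complex.exp_add]
    congr 1
    push_cast
    ring
  simp only [ModularForm.eta, h1, mul_pow, h2, mul_assoc]

theorem denominator_neg_inv {e e' : ℤ} (he' : e' = 0 ∨ e' = 1) {τ : ℂ}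
    (hτ : 0 < τ.im) (z₁ z₂ t : ℂ) :
    denominator (e / 2) (e' / 2) (-1 / τ) (z₁ / τ) (z₂ / τ) (t - z₁ * z₂ / τ) =
      (-1) ^ e' * I ^ (e' - e - e * e') * τ * denominator (e' / 2) (e / 2) τ z₁ z₂ t := by
  have hτ0 : τ ≠ 0 := by rintro rfl; simp at hτ
  set s := (-I * τ) ^ (1 / 2 : ℂ) with hs
  have hs2 : s ^ 2 = -I * τ := by
    rw [hs, ← Complex.cpow_nat_mul]; simp
  have hs0 : s ≠ 0 := by
    intro h; rw [h] at hs2; simp [hτ0] at hs2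
  have ha : (1 - 2 * (e' / 2 : ℝ)) = 0 ∨ (1 - 2 * (e' / 2 : ℝ)) = 1 := by
    rcases he' with rfl | rfl <;> norm_num
  have h1 : (z₁ / τ + z₂ / τ) = (z₁ + z₂) / τ := by ring
  have h2 : (z₁ / τ - z₂ / τ) / 2 = ((z₁ - z₂) / 2) / τ := by ring
  have h3 : ((z₁ + z₂) / τ) / 2 = ((z₁ + z₂) / 2) / τ := by ring
  rw [denominator, denominator, h1, h2, h3]
  simp only [jacobiTheta_neg_inv ha hτ, jacobiTheta_neg_inv (Or.inr rfl) hτ, eta_neg_inv hτ, ← hs]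
  set a : ℝ := 1 - 2 * (e' / 2 : ℝ) with hadef
  set b : ℝ := 1 - 2 * (e / 2 : ℝ) with hbdef
  set A := jacobiTheta 1 1 τ (z₁ + z₂)
  set B := jacobiTheta 1 1 τ ((z₁ - z₂) / 2)
  set C := jacobiTheta b a τ z₁
  set D := jacobiTheta b a τ z₂
  set F := jacobiTheta b a τ ((z₁ + z₂) / 2)
  set H := ModularForm.eta τ
  -- The quadratic forms in the theta factors differ by exactly `z₁z₂`, which cancels the shift of
  -- `t`.
  have hexp : cexp (π * I * (t - z₁ * z₂ / τ)) * (cexp (π * I * (z₁ + z₂) ^ 2 / τ) *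
      cexp (π * I * ((z₁ - z₂) / 2) ^ 2 / τ)) = cexp (π * I * t) * (cexp (π * I * z₁ ^ 2 / τ) *
      cexp (π * I * z₂ ^ 2 / τ) * cexp (π * I * ((z₁ + z₂) / 2) ^ 2 / τ)) := by
    simp only [← Complex.exp_add]
    congr 1
    field_simp
    ring
  have hconst : cexp (π * I / 2 * (2 * (((e / 2 : ℝ) : ℂ) - ((e' / 2 : ℝ) : ℂ)) -
      4 * ((e / 2 : ℝ) : ℂ) * ((e' / 2 : ℝ) : ℂ) - 1)) *
      cexp (-(π * I * (((1 : ℝ) : ℂ) * ((1 : ℝ) : ℂ)) / 2)) ^ 2 * (-I) =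
      (-1) ^ e' * I ^ (e' - e - e * e') * cexp (-(π * I * (a * b) / 2)) ^ 3 *
      cexp (π * I / 2 * (2 * (((e' / 2 : ℝ) : ℂ) - ((e / 2 : ℝ) : ℂ)) -
      4 * ((e' / 2 : ℝ) : ℂ) * ((e / 2 : ℝ) : ℂ) - 1)) := by
    have hI : ∀ n : ℤ, I ^ n = cexp (n * (π / 2 * I)) := fun n => by
      rw [Complex.exp_int_mul, Complex.exp_pi_div_two_mul_I]
    have hI' : -I = cexp (-(π / 2 * I)) := by
      rw [Complex.exp_neg, Complex.exp_pi_div_two_mul_I, inv_I]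
    rw [hI, hI', neg_one_zpow_eq_exp, ← Complex.exp_nat_mul, ← Complex.exp_nat_mul]
    simp only [← Complex.exp_add]
    refine Complex.exp_eq_exp_iff_exists_int.2 ⟨e * e' - 2 * e', ?_⟩
    rw [hadef, hbdef]
    push_cast
    ring
  set E1 := cexp (-(π * I * (((1 : ℝ) : ℂ) * ((1 : ℝ) : ℂ)) / 2))
  set E2 := cexp (-(π * I * (a * b) / 2))
  have hE2 : E2 ≠ 0 := Complex.exp_ne_zero _
  set X1 := cexp (π * I * (z₁ + z₂) ^ 2 / τ)
  set X2 := cexp (π * I * ((z₁ - z₂) / 2) ^ 2 / τ)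
  set Y1 := cexp (π * I * z₁ ^ 2 / τ)
  set Y2 := cexp (π * I * z₂ ^ 2 / τ)
  set Y3 := cexp (π * I * ((z₁ + z₂) / 2) ^ 2 / τ)
  have hY : Y1 * Y2 * Y3 ≠ 0 := by simp [Y1, Y2, Y3, Complex.exp_ne_zero]
  set T := cexp (π * I * (t - z₁ * z₂ / τ))
  set T' := cexp (π * I * t)
  set P := cexp (π * I / 2 * (2 * (((e / 2 : ℝ) : ℂ) - ((e' / 2 : ℝ) : ℂ)) -
      4 * ((e / 2 : ℝ) : ℂ) * ((e' / 2 : ℝ) : ℂ) - 1))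
  set Q := cexp (π * I / 2 * (2 * (((e' / 2 : ℝ) : ℂ) - ((e / 2 : ℝ) : ℂ)) -
      4 * ((e' / 2 : ℝ) : ℂ) * ((e / 2 : ℝ) : ℂ) - 1))
  have hden : E2 ^ 3 * s ^ 3 * (Y1 * Y2 * Y3) ≠ 0 := by positivity
  calc P * T * ((s * H) ^ 3 * (E1 * s * X1 * A) * (E1 * s * X2 * B) /
        ((E2 * s * Y1 * C) * (E2 * s * Y2 * D) * (E2 * s * Y3 * F)))
      = P * E1 ^ 2 * (T * (X1 * X2)) * s ^ 3 * s ^ 2 * (H ^ 3 * A * B) /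
        ((E2 ^ 3 * s ^ 3 * (Y1 * Y2 * Y3)) * (C * D * F)) := by ring
    _ = (P * E1 ^ 2 * (-I)) * T' * τ * (H ^ 3 * A * B) * (s ^ 3 * (Y1 * Y2 * Y3)) /
        ((E2 ^ 3 * s ^ 3 * (Y1 * Y2 * Y3)) * (C * D * F)) := by rw [hexp, hs2]; ring
    _ = (-1) ^ e' * I ^ (e' - e - e * e') * Q * T' * τ * (H ^ 3 * A * B) *
        (E2 ^ 3 * s ^ 3 * (Y1 * Y2 * Y3)) /
        ((E2 ^ 3 * s ^ 3 * (Y1 * Y2 * Y3)) * (C * D * F)) := by rw [hconst]; ring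
    _ = (-1) ^ e' * I ^ (e' - e - e * e') * Q * T' * τ * (H ^ 3 * A * B) / (C * D * F) := by
        rw [mul_comm _ (E2 ^ 3 * s ^ 3 * (Y1 * Y2 * Y3)), mul_div_mul_left _ _ hden]
    _ = _ := by ring

theorem denominator_add_one {e e' : ℤ} (he : e = 0 ∨ e = 1) (he' : e' = 0 ∨ e' = 1) (τ z₁ z₂ t : ℂ) :
    denominator (e / 2) (e' / 2) (τ + 1) z₁ z₂ t =
      cexp (3 * π * I * e' / 4) * denominator (|e - e'| / 2) (e' / 2) τ z₁ z₂ t := by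
  have h11 := jacobiTheta_one_add_one 1 τ
  have hc : cexp (π * I / 4) ≠ 0 := Complex.exp_ne_zero _
  rcases he' with rfl | rfl
  · have h2 : |e| = e := by rcases he with rfl | rfl <;> norm_num
    simp only [denominator, h2, sub_zero, jacobiTheta_one_add_one, eta_add_one_pow_three, Int.cast_zero,
      mul_zero, zero_div, Complex.exp_zero, one_mul]
    field_simp
  · have h1 : (1 - 2 * (((1 : ℤ) : ℝ) / 2)) = 0 := by norm_num
    have h0 : ∀ z, jacobiTheta 0 (1 - 2 * ((e : ℝ) / 2)) (τ + 1) z =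
        jacobiTheta 0 (1 - 2 * (((|e - 1| : ℤ) : ℝ) / 2)) τ z := by
      refine fun z => jacobiTheta_zero_add_one _ _ (e - 1) ?_ τ z
      rcases he with rfl | rfl <;> norm_num
    -- For `ε' = 1/2` the constant `2(ε - ε') - 4εε' - 1` equals `-2` whatever `ε` is.
    have hp : cexp (π * I / 2 * (2 * ((((e : ℝ) / 2 : ℝ) : ℂ) - ((((1 : ℤ) : ℝ) / 2 : ℝ) : ℂ)) -
        4 * (((e : ℝ) / 2 : ℝ) : ℂ) * ((((1 : ℤ) : ℝ) / 2 : ℝ) : ℂ) - 1)) =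
        cexp (π * I / 2 * (2 * (((((|e - 1| : ℤ) : ℝ) / 2 : ℝ) : ℂ) - ((((1 : ℤ) : ℝ) / 2 : ℝ) : ℂ)) -
        4 * ((((|e - 1| : ℤ) : ℝ) / 2 : ℝ) : ℂ) * ((((1 : ℤ) : ℝ) / 2 : ℝ) : ℂ) - 1)) := by
      congr 1
      push_cast
      ring
    have h3 : cexp (3 * π * I * ((1 : ℤ) : ℂ) / 4) = cexp (π * I / 4) ^ 3 := by
      rw [← Complex.exp_nat_mul]; congr 1; push_cast; ring
    rw [denominator, denominator, h1, hp, h3]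
    simp only [h11, h0, eta_add_one_pow_three]
    ring

/-- At a pole of the numerator one of the theta functions that `denominator` divides by vanishes, so
`denominator` takes the value `0` there by `x / 0 = 0`. A nonzero `denominator` therefore keeps `z₁`
and `z₂` off the lattice cosets. -/
theorem denominator_eq_zero {e e' : ℤ} {τ z₁ z₂ t : ℂ} {j : ℤ} {N K : ℤ}
    (h : z₁ + (e' / 2 + j + N) * τ + (K + e / 2) = 0 ∨ z₂ + (e' / 2 + j + N) * τ + (K + e / 2) = 0) :
    denominator (e / 2) (e' / 2) τ z₁ z₂ t = 0 := by
  have key : ∀ z : ℂ, z + (e' / 2 + j + N) * τ + (K + e / 2) = 0 →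
      jacobiTheta (1 - 2 * ((e' : ℝ) / 2)) (1 - 2 * ((e : ℝ) / 2)) τ z = 0 := by
    intro z hz
    refine jacobiTheta_eq_zero (N := -j - N - e') (K := -K - e) ?_
    push_cast
    linear_combination hz
  rcases h with h | h
  · rw [denominator, key _ h]; simp
  · rw [denominator, key _ h]; simp

/-! ### The index set `Ω`. -/

/-- The integral index set underlying `omega`. -/
noncomputable def intOmega (M : ℕ) : Finset (ℤ × ℤ) :=
  (Finset.Ico (-(M : ℤ)) M ×ˢ Finset.Ico (0 : ℤ) M).filter (fun p => (2 : ℤ) ∣ p.1 - p.2)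

theorem omega_eq_image (M : ℕ) (ε : ℝ) :
    omega M ε = (intOmega M).image fun p => (ε + p.1, ε + p.2) := by
  unfold omega intOmega
  congr!

theorem sum_omega (M : ℕ) (ε : ℝ) (f : ℝ × ℝ → ℂ) :
    ∑ p ∈ omega M ε, f p = ∑ p ∈ intOmega M, f (ε + p.1, ε + p.2) := by
  rw [omega_eq_image, Finset.sum_image]
  rintro ⟨a, b⟩ - ⟨a', b'⟩ - h
  simpa using h

/-- The second entry is its own residue. Its parity fixes the parity of the first entry, which
together with the residue modulo the odd `M` fixes that entry modulo `2M`; the interval from `-M` to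
`M` holds each such class once. -/
theorem bijOn_intOmega {M : ℕ} (hM : Odd M) :
    Set.BijOn (fun p : ℤ × ℤ => ((p.1 : ZMod M), (p.2 : ZMod M))) (intOmega M) Set.univ := by
  obtain ⟨r, hr⟩ := hM
  refine ⟨fun _ _ => Set.mem_univ _, ?_, ?_⟩
  · rintro ⟨a, b⟩ h ⟨a', b'⟩ h' heq
    simp only [intOmega, Finset.coe_filter, Finset.mem_product, Finset.mem_Ico, Set.mem_ofPred_eq] at h h'
    simp only [Prod.mk.injEq, ZMod.intCast_eq_intCast_iff_dvd_sub] at heq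
    obtain ⟨⟨x, hx⟩, ⟨y, hy⟩⟩ := heq
    have hy0 : y = 0 := by
      have h1 : y < 1 := by nlinarith
      have h2 : -1 < y := by nlinarith
      omega
    subst hy0
    have hx1 : x < 2 := by nlinarith
    have hx2 : -2 < x := by nlinarith
    have hbb : b = b' := by linarith
    have hxx : x = 0 := by
      have : x = 1 ∨ x = 0 ∨ x = -1 := by omega
      rcases this with rfl | rfl | rfl
      · omega
      · rfl
      · omega
    subst hxx
    simp only [Prod.mk.injEq]
    constructor <;> linarith
  · rintro ⟨x, y⟩ -
    have : NeZero M := ⟨by omega⟩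
    have hx := ZMod.val_lt x
    have hy := ZMod.val_lt y
    by_cases hpar : (2 : ℤ) ∣ (x.val : ℤ) - y.val
    · refine ⟨((x.val : ℤ), (y.val : ℤ)), ?_, by simp⟩
      simp only [intOmega, Finset.coe_filter, Finset.mem_product, Finset.mem_Ico, Set.mem_ofPred_eq]
      omega
    · refine ⟨((x.val : ℤ) - M, (y.val : ℤ)), ?_, by simp⟩
      simp only [intOmega, Finset.coe_filter, Finset.mem_product, Finset.mem_Ico, Set.mem_ofPred_eq]
      omega

theorem two_dvd_sub_of_mem_intOmega {M : ℕ} {p : ℤ × ℤ} (hp : p ∈ intOmega M) : 2 ∣ p.1 - p.2 :=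
  (Finset.mem_filter.1 hp).2

theorem neg_one_zpow_eq_of_two_dvd {j k : ℤ} (h : 2 ∣ j - k) : (-1 : ℂ) ^ j = (-1) ^ k := by
  obtain ⟨v, hv⟩ := h
  rw [show j = k + 2 * v by linarith, zpow_add₀ (by norm_num), zpow_mul]
  simp

theorem odd_of_gcd {M m : ℕ} (hgcd : Nat.gcd M (4 * m + 2) = 1) : Odd M := by
  rw [← Nat.not_even_iff_odd, even_iff_two_dvd]
  intro h
  have : 2 ∣ Nat.gcd M (4 * m + 2) := Nat.dvd_gcd h ⟨2 * m + 1, by ring⟩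
  rw [hgcd] at this
  omega

/-- The subtracted half of the numerator: the previous law with both pairs of indices exchanged.
Signs agree because the two entries of each pair have equal parity. -/
theorem halfPsi_neg_inv_swap (M m : ℕ) (hM : 1 ≤ M) (hgcd : Nat.gcd M (4 * m + 2) = 1)
    (e e' j k : ℤ) (hjk : 2 ∣ j - k) {τ : ℂ} (hτ : 0 < τ.im) (z₁ z₂ : ℂ) :
    cexp (2 * π * I * (m + 1 / 2) * (-(z₁ * z₂ / τ) / M)) * ((-1) ^ j *
      halfPsi M m (e / 2) (e' / 2 + k) (e' / 2 + j) (-1 / τ) (z₂ / τ) (z₁ / τ)) =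
    (-1) ^ e' * τ / M * ∑ p ∈ intOmega M, (-1) ^ p.1 * cexp (-(π * I * (2 * m + 1) / M *
      ((e / 2 + p.2) * (e' / 2 + j) + (e / 2 + p.1) * (e' / 2 + k)))) *
      halfPsi M m (e' / 2) (e / 2 + p.2) (e / 2 + p.1) τ z₂ z₁ := by
  have hb := bijOn_intOmega (odd_of_gcd hgcd)
  have h := halfPsi_neg_inv M m hM hgcd e e' k j ((dvd_sub_comm).1 hjk)
    ((intOmega M).image Prod.swap) ?_ ?_ hτ z₂ z₁
  · rw [Finset.sum_image (Prod.swap_injective.injOn)] at h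
    rw [mul_comm z₁ z₂, neg_one_zpow_eq_of_two_dvd hjk, h]
    congr 1
    refine Finset.sum_congr rfl fun p hp => ?_
    rw [neg_one_zpow_eq_of_two_dvd (two_dvd_sub_of_mem_intOmega hp),
      add_comm (((e : ℂ) / 2 + p.swap.2) * _)]
    rfl
  · have h1 : Set.BijOn (Prod.swap : ZMod M × ZMod M → _) Set.univ Set.univ :=
      Set.bijOn_univ.2 Prod.swap_bijective
    have h2 := h1.comp hb
    rw [Finset.coe_image]
    have h3 : Set.BijOn (Prod.swap : ℤ × ℤ → _) (Prod.swap '' (intOmega M : Set (ℤ × ℤ))) (intOmega M) := by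
      rw [Set.image_swap_eq_preimage_swap]
      exact ⟨fun x hx => hx, Prod.swap_injective.injOn, fun x hx => ⟨x.swap, by simpa using hx, by simp⟩⟩
    exact h2.comp h3
  · intro p hp
    obtain ⟨q, hq, rfl⟩ := Finset.mem_image.1 hp
    exact (dvd_sub_comm).1 (two_dvd_sub_of_mem_intOmega hq)

/-! ### Transformation of the characters. -/

theorem chMod_eq_zpow (M m : ℕ) (e e' j k : ℤ) (τ z₁ z₂ t : ℂ) :
    chMod M m (e / 2) (e' / 2) (e' / 2 + j) (e' / 2 + k) τ z₁ z₂ t =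
      (-1) ^ j * (psiMod M m (e / 2) (e' / 2 + j) (e' / 2 + k) τ z₁ z₂ t /
        denominator (e / 2) (e' / 2) τ z₁ z₂ t) := by
  rw [chMod, show ((e' / 2 + j - e' / 2 : ℝ) : ℂ) = (j : ℂ) by push_cast; ring, cpow_intCast]

/-- Away from the zeros of the denominator, `chMod` is a difference of lattice series. -/
theorem chMod_eq_halfPsi (M m : ℕ) (hM : 1 ≤ M) (e e' j k : ℤ) {τ : ℂ} (hτ : 0 < τ.im) (z₁ z₂ t : ℂ)
    (hD : denominator (e / 2) (e' / 2) τ z₁ z₂ t ≠ 0) :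
    chMod M m (e / 2) (e' / 2) (e' / 2 + j) (e' / 2 + k) τ z₁ z₂ t =
      (-1) ^ j * (cexp (2 * π * I * (m + 1 / 2) * (t / M)) * (I / (2 * π)) *
      (halfPsi M m (e / 2) (e' / 2 + j) (e' / 2 + k) τ z₁ z₂ -
        halfPsi M m (e / 2) (e' / 2 + k) (e' / 2 + j) τ z₂ z₁) /
        denominator (e / 2) (e' / 2) τ z₁ z₂ t) := by
  rw [chMod_eq_zpow, psiMod_eq_halfPsi M m hM _ _ _ hτ]
  · intro c d h
    refine hD (denominator_eq_zero (j := j) (N := c * M) (K := d) (Or.inl ?_))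
    rw [← h]; push_cast; ring
  · intro c d h
    refine hD (denominator_eq_zero (j := k) (N := c * M) (K := d) (Or.inr ?_))
    rw [← h]; push_cast; ring

theorem chMod_neg_inv_intOmega (M m : ℕ) (hM : 1 ≤ M) (hgcd : Nat.gcd M (4 * m + 2) = 1) {e e' : ℤ}
    (he' : e' = 0 ∨ e' = 1) (j k : ℤ) (hjk : 2 ∣ j - k) {τ : ℂ} (hτ : 0 < τ.im) (z₁ z₂ t : ℂ) :
    chMod M m (e / 2) (e' / 2) (e' / 2 + j) (e' / 2 + k) (-1 / τ) (z₁ / τ) (z₂ / τ) (t - z₁ * z₂ / τ) =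
      I ^ (e * e' + e - e') / M * ∑ p ∈ intOmega M, cexp (-(π * I * (2 * m + 1) / M *
        ((e / 2 + p.2) * (e' / 2 + j) + (e / 2 + p.1) * (e' / 2 + k)))) *
        chMod M m (e' / 2) (e / 2) (e / 2 + p.1) (e / 2 + p.2) τ z₁ z₂ t := by
  have hτ0 : τ ≠ 0 := by rintro rfl; simp at hτ
  have hτ' : 0 < (-1 / τ).im := by
    have := UpperHalfPlane.im_inv_neg_coe_pos ⟨τ, hτ⟩
    convert this using 2
    simp [neg_div, inv_neg]
  have hD := denominator_neg_inv (e := e) he' hτ z₁ z₂ t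
  -- All summands on the right share one denominator, which vanishes exactly when the transformed
  -- one does; in that case both sides are `0` by convention.
  by_cases h0 : denominator (e' / 2) (e / 2) τ z₁ z₂ t = 0
  · rw [h0, mul_zero] at hD
    rw [chMod_eq_zpow, hD, div_zero, mul_zero, Finset.sum_eq_zero, mul_zero]
    intro p _
    rw [chMod_eq_zpow, h0, div_zero, mul_zero, mul_zero]
  · have hI : I ^ (e' - e - e * e') ≠ 0 := zpow_ne_zero _ I_ne_zero
    have hs : (-1 : ℂ) ^ e' ≠ 0 := zpow_ne_zero _ (by norm_num)
    have h1 : denominator (e / 2) (e' / 2) (-1 / τ) (z₁ / τ) (z₂ / τ) (t - z₁ * z₂ / τ) ≠ 0 := by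
      rw [hD]; exact mul_ne_zero (mul_ne_zero (mul_ne_zero hs hI) hτ0) h0
    rw [chMod_eq_halfPsi M m hM _ _ _ _ hτ' _ _ _ h1, hD]
    simp_rw [chMod_eq_halfPsi M m hM e' e _ _ hτ _ _ _ h0]
    have A1 := halfPsi_neg_inv M m hM hgcd e e' j k hjk (intOmega M) (bijOn_intOmega (odd_of_gcd hgcd))
      (fun p hp => two_dvd_sub_of_mem_intOmega hp) hτ z₁ z₂
    have A2 := halfPsi_neg_inv_swap M m hM hgcd e e' j k hjk hτ z₁ z₂
    set D := denominator (e' / 2) (e / 2) τ z₁ z₂ t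
    have ht : cexp (2 * π * I * (m + 1 / 2) * ((t - z₁ * z₂ / τ) / M)) =
        cexp (2 * π * I * (m + 1 / 2) * (t / M)) *
          cexp (2 * π * I * (m + 1 / 2) * (-(z₁ * z₂ / τ) / M)) := by
      rw [← Complex.exp_add]; congr 1; ring
    have hIinv : I ^ (e * e' + e - e') = (I ^ (e' - e - e * e'))⁻¹ := by
      rw [← zpow_neg]; congr 1; ring
    rw [ht, hIinv]
    calc _ = cexp (2 * π * I * (m + 1 / 2) * (t / M)) * (I / (2 * π)) *
          (cexp (2 * π * I * (m + 1 / 2) * (-(z₁ * z₂ / τ) / M)) * ((-1) ^ j *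
            halfPsi M m (e / 2) (e' / 2 + j) (e' / 2 + k) (-1 / τ) (z₁ / τ) (z₂ / τ)) -
          cexp (2 * π * I * (m + 1 / 2) * (-(z₁ * z₂ / τ) / M)) * ((-1) ^ j *
            halfPsi M m (e / 2) (e' / 2 + k) (e' / 2 + j) (-1 / τ) (z₂ / τ) (z₁ / τ))) /
          ((-1) ^ e' * I ^ (e' - e - e * e') * τ * D) := by ring
      _ = _ := by
        rw [A1, A2, ← mul_sub, ← Finset.sum_sub_distrib]
        rw [show ∀ x y z w S : ℂ, x * y * ((-1) ^ e' * τ / M * S) / ((-1) ^ e' * z * τ * w) =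
          z⁻¹ / M * (x * y / w * S) from fun x y z w S => by field_simp]
        congr 1
        rw [Finset.mul_sum]
        refine Finset.sum_congr rfl fun p _ => ?_
        ring

theorem chMod_add_one_intOmega (M m : ℕ) (hM : 1 ≤ M) {e e' : ℤ} (he : e = 0 ∨ e = 1)
    (he' : e' = 0 ∨ e' = 1) (j k : ℤ) (hjk : 2 ∣ j - k) {τ : ℂ} (hτ : 0 < τ.im) (z₁ z₂ t : ℂ) :
    chMod M m (e / 2) (e' / 2) (e' / 2 + j) (e' / 2 + k) (τ + 1) z₁ z₂ t =
      (-1) ^ (e * e') * cexp (π * I * (2 * m + 1) / M * ((e' / 2 + j) * (e' / 2 + k)) +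
        π * I * ((e' / 2 + j) - 5 / 2 * (e' / 2))) *
        chMod M m ((|e - e'| : ℤ) / 2) (e' / 2) (e' / 2 + j) (e' / 2 + k) τ z₁ z₂ t := by
  have hτ' : 0 < (τ + 1).im := by simpa using hτ
  have hD := denominator_add_one he he' τ z₁ z₂ t
  have hc : cexp (3 * π * I * e' / 4) ≠ 0 := Complex.exp_ne_zero _
  by_cases h0 : denominator ((|e - e'| : ℤ) / 2) (e' / 2) τ z₁ z₂ t = 0
  · rw [h0, mul_zero] at hD
    rw [chMod_eq_zpow, chMod_eq_zpow, hD, h0]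
    simp
  · have h1 : denominator (e / 2) (e' / 2) (τ + 1) z₁ z₂ t ≠ 0 := by
      rw [hD]; exact mul_ne_zero hc h0
    have hee : e + e' = |e - e'| + 2 * (e * e') := by
      rcases he with rfl | rfl <;> rcases he' with rfl | rfl <;> rfl
    rw [chMod_eq_halfPsi M m hM _ _ _ _ hτ' _ _ _ h1, chMod_eq_halfPsi M m hM _ _ _ _ hτ _ _ _ h0, hD,
      halfPsi_add_one M m hM e e' _ _ j k hjk hee,
      halfPsi_add_one M m hM e e' _ _ k j ((dvd_sub_comm).1 hjk) hee, zpow_add₀ (by norm_num),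
      zpow_add₀ (by norm_num), ← neg_one_zpow_eq_of_two_dvd hjk,
      mul_comm ((e' / 2 + k : ℂ)) (e' / 2 + j), Complex.exp_add]
    -- The exponent `-5/2 ε'` is the shift by `ε'` in the index combined with the factor `exp(3πi
    -- ε'/2)` of the denominator.
    have hx : cexp (π * I * ((e' / 2 + j) - 5 / 2 * (e' / 2))) =
        (-1) ^ j * (cexp (3 * π * I * e' / 4))⁻¹ := by
      rw [neg_one_zpow_eq_exp, ← Complex.exp_neg, ← Complex.exp_add]
      congr 1
      ring
    rw [hx]
    field_simp

theorem chMod_neg_inv (m M : ℕ) (hM : 1 ≤ M) (hgcd : Nat.gcd M (4 * m + 2) = 1) {ε ε' : ℝ}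
    (hε : ε = 0 ∨ ε = 1 / 2) (hε' : ε' = 0 ∨ ε' = 1 / 2) {j k : ℝ} (hjk : (j, k) ∈ omega M ε')
    {τ : ℂ} (hτ : 0 < τ.im) (z₁ z₂ t : ℂ) :
    chMod M m ε ε' j k (-1 / τ) (z₁ / τ) (z₂ / τ) (t - z₁ * z₂ / τ) =
      I ^ ((4 * ε * ε' + 2 * ε - 2 * ε' : ℝ) : ℂ) / M *
        ∑ p ∈ omega M ε, cexp (-(π * I * (2 * m + 1) / M * (p.2 * j + p.1 * k))) *
          chMod M m ε' ε p.1 p.2 τ z₁ z₂ t := by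
  obtain ⟨e, -, rfl⟩ : ∃ e : ℤ, (e = 0 ∨ e = 1) ∧ ε = e / 2 := by
    rcases hε with rfl | rfl
    · exact ⟨0, by simp⟩
    · exact ⟨1, by simp⟩
  obtain ⟨e', he', rfl⟩ : ∃ e : ℤ, (e = 0 ∨ e = 1) ∧ ε' = e / 2 := by
    rcases hε' with rfl | rfl
    · exact ⟨0, by simp⟩
    · exact ⟨1, by simp⟩
  rw [omega_eq_image] at hjk
  obtain ⟨q, hq, h⟩ := Finset.mem_image.1 hjk
  obtain ⟨rfl, rfl⟩ := Prod.mk.inj h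
  rw [chMod_neg_inv_intOmega M m hM hgcd he' _ _ (two_dvd_sub_of_mem_intOmega hq) hτ, sum_omega,
    show ((4 * (e / 2) * (e' / 2) + 2 * (e / 2) - 2 * (e' / 2) : ℝ) : ℂ) = ((e * e' + e - e' : ℤ) : ℂ) by
      push_cast; ring, cpow_intCast]
  push_cast
  rfl

theorem chMod_add_one (m M : ℕ) (hM : 1 ≤ M) {ε ε' : ℝ}
    (hε : ε = 0 ∨ ε = 1 / 2) (hε' : ε' = 0 ∨ ε' = 1 / 2) {j k : ℝ} (hjk : (j, k) ∈ omega M ε')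
    {τ : ℂ} (hτ : 0 < τ.im) (z₁ z₂ t : ℂ) :
    chMod M m ε ε' j k (τ + 1) z₁ z₂ t =
      (-1 : ℂ) ^ ((4 * ε * ε' : ℝ) : ℂ) *
        cexp (π * I * (2 * m + 1) / M * (j * k) + π * I * (j - 5 / 2 * ε')) *
        chMod M m |ε - ε'| ε' j k τ z₁ z₂ t := by
  obtain ⟨e, he, rfl⟩ : ∃ e : ℤ, (e = 0 ∨ e = 1) ∧ ε = e / 2 := by
    rcases hε with rfl | rfl
    · exact ⟨0, by simp⟩
    · exact ⟨1, by simp⟩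
  obtain ⟨e', he', rfl⟩ : ∃ e : ℤ, (e = 0 ∨ e = 1) ∧ ε' = e / 2 := by
    rcases hε' with rfl | rfl
    · exact ⟨0, by simp⟩
    · exact ⟨1, by simp⟩
  rw [omega_eq_image] at hjk
  obtain ⟨q, hq, h⟩ := Finset.mem_image.1 hjk
  obtain ⟨rfl, rfl⟩ := Prod.mk.inj h
  have habs : |(e / 2 - e' / 2 : ℝ)| = ((|e - e'| : ℤ) : ℝ) / 2 := by
    rw [← sub_div, abs_div, abs_two]; push_cast; rfl
  rw [chMod_add_one_intOmega M m hM he he' _ _ (two_dvd_sub_of_mem_intOmega hq) hτ, habs,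
    show ((4 * (e / 2) * (e' / 2) : ℝ) : ℂ) = ((e * e' : ℤ) : ℂ) by push_cast; ring, cpow_intCast]
  push_cast
  rfl

/-! ### The action of `SL(2, ℤ)` and the span. -/

theorem act_mul (A B : SL(2, ℤ)) (F : Domain → ℂ) : act (A * B) F = act B (act A F) := by
  funext ⟨τ, z₁, z₂, t⟩
  have hB := UpperHalfPlane.denom_ne_zero (B : GL (Fin 2) ℝ) τ
  have hA := UpperHalfPlane.denom_ne_zero (A : GL (Fin 2) ℝ) (B • τ)
  have hd : (B 0 0 : ℂ) * B 1 1 - B 0 1 * B 1 0 = 1 := by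
    have := B.det_coe
    rw [Matrix.det_fin_two] at this
    exact_mod_cast this
  have eB : ((B • τ : UpperHalfPlane) : ℂ) = (B 0 0 * τ + B 0 1) / (B 1 0 * τ + B 1 1) := by
    simpa using UpperHalfPlane.coe_specialLinearGroup_apply B τ
  have hB' : (B 1 0 : ℂ) * τ + B 1 1 ≠ 0 := by simpa [UpperHalfPlane.denom] using hB
  have hA' : (A 1 0 : ℂ) * ((B • τ : UpperHalfPlane) : ℂ) + A 1 1 ≠ 0 := by
    simpa [UpperHalfPlane.denom] using hA
  have e10 : ((A * B) 1 0 : ℂ) = A 1 0 * B 0 0 + A 1 1 * B 1 0 := by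
    have : (A * B) 1 0 = A 1 0 * B 0 0 + A 1 1 * B 1 0 := by
      simp [Matrix.mul_apply, Fin.sum_univ_two]
    rw [this]; push_cast; rfl
  have e11 : ((A * B) 1 1 : ℂ) = A 1 0 * B 0 1 + A 1 1 * B 1 1 := by
    have : (A * B) 1 1 = A 1 0 * B 0 1 + A 1 1 * B 1 1 := by
      simp [Matrix.mul_apply, Fin.sum_univ_two]
    rw [this]; push_cast; rfl
  have hw : ((A * B) 1 0 : ℂ) * τ + (A * B) 1 1 =
      (A 1 0 * ((B • τ : UpperHalfPlane) : ℂ) + A 1 1) * (B 1 0 * τ + B 1 1) := by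
    rw [e10, e11, eB]; field_simp; ring
  simp only [act, hw, mul_smul]
  set u := (A 1 0 : ℂ) * ((B • τ : UpperHalfPlane) : ℂ) + A 1 1 with hu
  set w := (B 1 0 : ℂ) * τ + B 1 1 with hwdef
  -- The cocycle identity behind the additivity of the shifts of `t`; it uses that `B` has
  -- determinant one.
  have key : ((A * B) 1 0 : ℂ) * w = A 1 0 + B 1 0 * (u * w) := by
    rw [e10, hu, eB]
    field_simp
    rw [hwdef]
    linear_combination (A 1 0 : ℂ) * hd
  have h4 : t - ((A * B) 1 0 : ℂ) * (2 * z₁ * z₂) / (2 * (u * w)) =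
      t - (B 1 0 : ℂ) * (2 * z₁ * z₂) / (2 * w) - (A 1 0 : ℂ) * (2 * (z₁ / w) * (z₂ / w)) / (2 * u) := by
    field_simp
    linear_combination -z₁ * z₂ * key
  rw [h4, mul_comm u w, div_div, div_div]

theorem act_one (F : Domain → ℂ) : act 1 F = F := by
  funext ⟨τ, z₁, z₂, t⟩
  simp [act]

/-- The action of a fixed matrix, as a linear map. -/
noncomputable def actLinear (A : SL(2, ℤ)) : (Domain → ℂ) →ₗ[ℂ] Domain → ℂ where
  toFun := act A
  map_add' _ _ := rfl
  map_smul' _ _ := rfl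

theorem act_mem_span {A : SL(2, ℤ)} {S : Set (Domain → ℂ)}
    (h : ∀ F ∈ S, act A F ∈ Submodule.span ℂ S) :
    ∀ F ∈ Submodule.span ℂ S, act A F ∈ Submodule.span ℂ S := by
  have : Submodule.span ℂ S ≤ (Submodule.span ℂ S).comap (actLinear A) :=
    Submodule.span_le.2 fun F hF => h F hF
  exact fun F hF => this hF

theorem act_S_mem_span (m M : ℕ) (hM : 1 ≤ M) (hgcd : Nat.gcd M (4 * m + 2) = 1) :
    ∀ F ∈ family M m, act ModularGroup.S F ∈ Submodule.span ℂ (family M m) := by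
  rintro F ⟨ε, ε', j, k, hε, hε', hjk, rfl⟩
  have h : act ModularGroup.S (fun h => chMod M m ε ε' j k (h.1 : ℂ) h.2.1 h.2.2.1 h.2.2.2) =
      (I ^ ((4 * ε * ε' + 2 * ε - 2 * ε' : ℝ) : ℂ) / M) •
        ∑ p ∈ omega M ε, cexp (-(π * I * (2 * m + 1) / M * (p.2 * j + p.1 * k))) •
          fun h : Domain => chMod M m ε' ε p.1 p.2 (h.1 : ℂ) h.2.1 h.2.2.1 h.2.2.2 := by
    funext ⟨τ, z₁, z₂, t⟩
    simp only [Pi.smul_apply, Finset.sum_apply, smul_eq_mul]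
    rw [← chMod_neg_inv m M hM hgcd hε hε' hjk τ.im_pos]
    have e1 : ((ModularGroup.S • τ : UpperHalfPlane) : ℂ) = -1 / τ := by
      rw [UpperHalfPlane.modular_S_smul]
      simp [neg_div, inv_neg]
    have e2 : (ModularGroup.S 1 0 : ℂ) = 1 := by simp [ModularGroup.S]
    have e3 : (ModularGroup.S 1 1 : ℂ) = 0 := by simp [ModularGroup.S]
    have hτ : (τ : ℂ) ≠ 0 := UpperHalfPlane.ne_zero τ
    simp only [act, e1, e2, e3, one_mul, add_zero]
    congr 1
    field_simp
  rw [h]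
  refine Submodule.smul_mem _ _ (Submodule.sum_mem _ fun p hp => Submodule.smul_mem _ _ ?_)
  exact Submodule.subset_span ⟨ε', ε, p.1, p.2, hε', hε, hp, rfl⟩

theorem act_T_mem_span (m M : ℕ) (hM : 1 ≤ M) :
    ∀ F ∈ family M m, act ModularGroup.T F ∈ Submodule.span ℂ (family M m) := by
  rintro F ⟨ε, ε', j, k, hε, hε', hjk, rfl⟩
  have h : act ModularGroup.T (fun h => chMod M m ε ε' j k (h.1 : ℂ) h.2.1 h.2.2.1 h.2.2.2) =
      ((-1 : ℂ) ^ ((4 * ε * ε' : ℝ) : ℂ) *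
        cexp (π * I * (2 * m + 1) / M * (j * k) + π * I * (j - 5 / 2 * ε'))) •
          fun h : Domain => chMod M m |ε - ε'| ε' j k (h.1 : ℂ) h.2.1 h.2.2.1 h.2.2.2 := by
    funext ⟨τ, z₁, z₂, t⟩
    simp only [Pi.smul_apply, smul_eq_mul]
    rw [← chMod_add_one m M hM hε hε' hjk τ.im_pos]
    have e1 : ((ModularGroup.T • τ : UpperHalfPlane) : ℂ) = τ + 1 := by
      rw [UpperHalfPlane.modular_T_smul, UpperHalfPlane.coe_vadd]
      push_cast; ring
    have e2 : (ModularGroup.T 1 0 : ℂ) = 0 := by simp [ModularGroup.T]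
    have e3 : (ModularGroup.T 1 1 : ℂ) = 1 := by simp [ModularGroup.T]
    simp only [act, e1, e2, e3, zero_mul, zero_add, div_one, zero_div, sub_zero]
  rw [h]
  refine Submodule.smul_mem _ _ (Submodule.subset_span ⟨|ε - ε'|, ε', j, k, ?_, hε', hjk, rfl⟩)
  rcases hε with rfl | rfl <;> rcases hε' with rfl | rfl <;> norm_num

theorem act_span_family (m M : ℕ) (hM : 1 ≤ M) (hgcd : Nat.gcd M (4 * m + 2) = 1) (A : SL(2, ℤ)) :
    ∀ F ∈ Submodule.span ℂ (family M m), act A F ∈ Submodule.span ℂ (family M m) := by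
  let V : Submonoid SL(2, ℤ) :=
    { carrier := {A | ∀ F ∈ Submodule.span ℂ (family M m), act A F ∈ Submodule.span ℂ (family M m)}
      one_mem' := fun F hF => by rwa [act_one]
      mul_mem' := fun {A B} hA hB F hF => by rw [act_mul]; exact hB _ (hA F hF) }
  have hS : ModularGroup.S ∈ V := act_mem_span (act_S_mem_span m M hM hgcd)
  have hT : ModularGroup.T ∈ V := act_mem_span (act_T_mem_span m M hM)
  have hS' : ModularGroup.S⁻¹ ∈ V := by
    have : ModularGroup.S⁻¹ = ModularGroup.S * ModularGroup.S * ModularGroup.S := by decide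
    rw [this]
    exact V.mul_mem (V.mul_mem hS hS) hS
  -- Stability under a matrix does not formally give stability under its inverse, so the inverse is
  -- written as a positive word, from `(ST)³ = S²` and `S⁴ = 1`.
  have hT' : ModularGroup.T⁻¹ ∈ V := by
    have : ModularGroup.T⁻¹ = ModularGroup.S * ModularGroup.S * ModularGroup.S * ModularGroup.T *
      ModularGroup.S * ModularGroup.T * ModularGroup.S := by decide
    rw [this]
    exact V.mul_mem (V.mul_mem (V.mul_mem (V.mul_mem (V.mul_mem (V.mul_mem hS hS) hS) hT) hS) hT) hS
  have hA : A ∈ Subgroup.closure {ModularGroup.S, ModularGroup.T} := by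
    rw [SpecialLinearGroup.SL2Z_generators]; trivial
  have hmem : A ∈ V ∧ A⁻¹ ∈ V := by
    induction hA using Subgroup.closure_induction with
    | mem x hx =>
      rcases hx with rfl | rfl
      · exact ⟨hS, hS'⟩
      · exact ⟨hT, hT'⟩
    | one => exact ⟨V.one_mem, by rw [inv_one]; exact V.one_mem⟩
    | mul x y _ _ hx hy =>
      exact ⟨V.mul_mem hx.1 hy.1, by rw [mul_inv_rev]; exact V.mul_mem hy.2 hx.2⟩
    | inv x _ hx => exact ⟨hx.2, by rw [inv_inv]; exact hx.1⟩
  exact hmem.1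

end OspModular

theorem theorem5p12 (m M : ℕ) (hM : 1 ≤ M) (hgcd : Nat.gcd M (4 * m + 2) = 1) :
    (∀ ε ε' : ℝ, (ε = 0 ∨ ε = 1 / 2) → (ε' = 0 ∨ ε' = 1 / 2) →
      ∀ j k : ℝ, (j, k) ∈ OspModular.omega M ε' →
        ∀ τ z₁ z₂ t : ℂ, 0 < τ.im →
          OspModular.chMod M m ε ε' j k (-1 / τ) (z₁ / τ) (z₂ / τ) (t - z₁ * z₂ / τ) =
              Complex.I ^ ((4 * ε * ε' + 2 * ε - 2 * ε' : ℝ) : ℂ) / M *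
                ∑ p ∈ OspModular.omega M ε,
                  Complex.exp (-(Real.pi * Complex.I * (2 * m + 1) / M * (p.2 * j + p.1 * k))) *
                    OspModular.chMod M m ε' ε p.1 p.2 τ z₁ z₂ t ∧
          OspModular.chMod M m ε ε' j k (τ + 1) z₁ z₂ t =
              (-1 : ℂ) ^ ((4 * ε * ε' : ℝ) : ℂ) *
                Complex.exp (Real.pi * Complex.I * (2 * m + 1) / M * (j * k)
                  + Real.pi * Complex.I * (j - 5 / 2 * ε')) *
                OspModular.chMod M m |ε - ε'| ε' j k τ z₁ z₂ t) ∧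
    (∀ (A : Matrix.SpecialLinearGroup (Fin 2) ℤ),
      ∀ F ∈ Submodule.span ℂ (OspModular.family M m),
        OspModular.act A F ∈ Submodule.span ℂ (OspModular.family M m)) :=
  ⟨fun _ _ hε hε' _ _ hjk _ z₁ z₂ t hτ =>
    ⟨OspModular.chMod_neg_inv m M hM hgcd hε hε' hjk hτ z₁ z₂ t,
      OspModular.chMod_add_one m M hM hε hε' hjk hτ z₁ z₂ t⟩,
    fun A => OspModular.act_span_family m M hM hgcd A⟩
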